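/- Let $\mathbb X=\{1,\dots,m\}$ and, for every $\varepsilon\in(0,\varepsilon_0]$, let $(\eta_{\varepsilon,n},\kappa_{\varepsilon,n},\zeta_{\varepsilon,n})$, $n=0,1,\dots$, be a Markov renewal process, i.e. a homogeneous Markov chain with phase space $\mathbb X\times[0,\infty)\times\{0,1\}$, with $\kappa_{\varepsilon,0}=0$, $\zeta_{\varepsilon,0}=0$, an arbitrary distribution of $\eta_{\varepsilon,0}$, and transition probabilities that depend on the current state through its first component only. Put $p_{\varepsilon,ij}=\mathsf P_i\{\eta_{\varepsilon,1}=j\}$ and $p_{\varepsilon,i}=\mathsf P_i\{\zeta_{\varepsilon,1}=1\}$, where $\mathsf P_i$ is the conditional probability given $\eta_{\varepsilon,0}=i$. Assume: **A**: $0<\max_{i}p_{\varepsilon,i}\to0$ as $\varepsilon\to0$. **B**: there is a ring chain of states $i_0,i_1,\dots,i_N=i_0$ which contains all states of $\mathbb X$ and is such that $\varliminf_{\varepsilon\to0}p_{\varepsilon,i_{k-1}i_k}>0$ for $k=1,\dots,N$. By **B** the chain $\eta_{\varepsilon,n}$ is ergodic (all states communicate) for all small $\varepsilon$; let $\pi_{\varepsilon,i}$,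 $i\in\mathbb X$, be its stationary distribution, $p_\varepsilon=\sum_i\pi_{\varepsilon,i}p_{\varepsilon,i}$ and $v_\varepsilon=p_\varepsilon^{-1}$. Let $f_{\varepsilon,i}\ge0$, $i\in\mathbb X$, be nonrandom numbers, $f_\varepsilon=v_\varepsilon\sum_i\pi_{\varepsilon,i}f_{\varepsilon,i}$, and assume **H**: $f_\varepsilon>0$ for all sufficiently small $\varepsilon$. Let $\nu_\varepsilon=\min(n\ge1:\zeta_{\varepsilon,n}=1)$ and $\nu_\varepsilon(t)=\sum_{n=1}^{[t\nu_\varepsilon]}f_{\varepsilon,\eta_{\varepsilon,n-1}}$, $t\ge0$, and let $\nu_0$ be exponentially distributed with parameter $1$. Write $\stackrel{\mathsf J}{\longrightarrow}$ for weak convergence in the space of càdlàg functions on the indicated time interval with the Skorokhod J-topology, and consider the condition **I**: $f_\varepsilon\to f_0$ as $\varepsilon\to0$, for some $f_0\in[0,\infty]$. Then: (i) $f_\varepsilon^{-1}\nu_\varepsilon(t),\ t\ge0\ \stackrel{\mathsf J}{\longrightarrow}\ t\nu_0,\ t\ge0$, as $\varepsilon\to0$, for any initial distributions. (ii) Condition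 **I** is necessary and sufficient for the convergence in distribution $\nu_\varepsilon(1)\stackrel{d}{\longrightarrow}\nu$ as $\varepsilon\to0$ to some non-negative, proper or improper (i.e. $[0,\infty]$-valued), random variable $\nu$: if the convergence holds for some family of initial distributions, then **I** holds; if **I** holds, then the convergence holds for any family of initial distributions. (iii) In this case $\nu\stackrel{d}{=}f_0\nu_0$. (iv) If **I** holds with $f_0\in[0,\infty)$, then $\nu_\varepsilon(t),\ t\ge0\ \stackrel{\mathsf J}{\longrightarrow}\ f_0\nu_0t,\ t\ge0$, as $\varepsilon\to0$. (v) If **I** holds with $f_0=\infty$, then $\min(T,\nu_\varepsilon(t)),\ t>0\ \stackrel{\mathsf J}{\longrightarrow}\ h_T(t)=T,\ t>0$, as $\varepsilon\to0$, for every $T>0$, and, thus, (vi) $\nu_\varepsilon(t)\stackrel{\mathsf P}{\longrightarrow}\infty$ as $\varepsilon\to0$, for every $t>0$. -/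

import Mathlib

open MeasureTheory ProbabilityTheory Filter Topology Set
open scoped NNReal ENNReal

/-! ### Càdlàg functions and the Skorokhod J-topology -/

/-- The space `D(I)` of real càdlàg functions on an interval `I ⊆ ℝ`. -/
structure CadlagFun (I : Set ℝ) where
  toFun : I → ℝ
  right_cont : ∀ t : I, ContinuousWithinAt toFun (Ici t) t
  left_lim : ∀ t : I, ∃ l : ℝ, Tendsto toFun (𝓝[<] t) (𝓝 l)

namespace CadlagFun

variable {I : Set ℝ}

/-- Basic J-neighbourhood of `x`: the functions `y` such that, for some increasing bijective time
change `r` of `I`, both `|r(s) - s| < δ` and `|y(r(s)) - x(s)| < δ` for all `s ∈ K`. -/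
def jBall (x : CadlagFun I) (K : Set I) (δ : ℝ) : Set (CadlagFun I) :=
  {y | ∃ r : I ≃o I, ∀ s ∈ K,
    |((r s : I) : ℝ) - (s : ℝ)| < δ ∧ |y.toFun (r s) - x.toFun s| < δ}

theorem jBall_mono (x : CadlagFun I) {K L : Set I} {δ η : ℝ} (hK : L ⊆ K) (hδ : δ ≤ η) :
    x.jBall K δ ⊆ x.jBall L η := by
  rintro y ⟨r, hr⟩
  exact ⟨r, fun s hs => ⟨(hr s (hK hs)).1.trans_le hδ, (hr s (hK hs)).2.trans_le hδ⟩⟩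

/-- The Skorokhod J-topology (`J₁`) on `D(I)`: the sets `jBall x K δ`, for `K` compact and `δ > 0`,
form a base of neighbourhoods of `x`. -/
instance : TopologicalSpace (CadlagFun I) where
  IsOpen U := ∀ x ∈ U, ∃ K : Set I, IsCompact K ∧ ∃ δ : ℝ, 0 < δ ∧ x.jBall K δ ⊆ U
  isOpen_univ := fun _ _ => ⟨∅, isCompact_empty, 1, one_pos, subset_univ _⟩
  isOpen_inter := by
    intro U V hU hV x hx
    obtain ⟨K, hK, δ, hδ, h⟩ := hU x hx.1
    obtain ⟨L, hL, η, hη, h'⟩ := hV x hx.2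
    exact ⟨K ∪ L, hK.union hL, min δ η, lt_min hδ hη, subset_inter
      ((x.jBall_mono subset_union_left (min_le_left _ _)).trans h)
      ((x.jBall_mono subset_union_right (min_le_right _ _)).trans h')⟩
  isOpen_sUnion := by
    intro S hS x hx
    obtain ⟨U, hU, hxU⟩ := hx
    obtain ⟨K, hK, δ, hδ, h⟩ := hS U hU x hxU
    exact ⟨K, hK, δ, hδ, h.trans (subset_sUnion_of_mem hU)⟩

instance : MeasurableSpace (CadlagFun I) := borel _

instance : BorelSpace (CadlagFun I) := ⟨rfl⟩

/-- A continuous function of real time, seen as an element of `D(I)`. -/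
def ofContinuous (I : Set ℝ) (g : ℝ → ℝ) (hg : Continuous g) : CadlagFun I where
  toFun t := g t
  right_cont _ := (hg.comp continuous_subtype_val).continuousWithinAt
  left_lim t := ⟨g t, ((hg.comp continuous_subtype_val).tendsto t).mono_left nhdsWithin_le_nhds⟩

/-- The function `t ↦ φ (x t)` for a continuous `φ`. -/
def map (φ : ℝ → ℝ) (hφ : Continuous φ) (x : CadlagFun I) : CadlagFun I where
  toFun t := φ (x.toFun t)
  right_cont t := hφ.continuousAt.comp_continuousWithinAt (x.right_cont t)
  left_lim t := by
    obtain ⟨l, hl⟩ := x.left_lim t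
    exact ⟨φ l, (hφ.tendsto l).comp hl⟩

/-- The function `t ↦ a * x t`. -/
def scale (a : ℝ) (x : CadlagFun I) : CadlagFun I :=
  x.map (fun y => a * y) (continuous_const.mul continuous_id)

/-- The function `t ↦ min T (x t)`. -/
def cut (T : ℝ) (x : CadlagFun I) : CadlagFun I :=
  x.map (fun y => min T y) (continuous_const.min continuous_id)

/-- The linear function `t ↦ t * a`. -/
def linear (I : Set ℝ) (a : ℝ) : CadlagFun I :=
  ofContinuous I (fun t => t * a) (continuous_id.mul continuous_const)

/-- The constant function `t ↦ a`. -/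
def const (I : Set ℝ) (a : ℝ) : CadlagFun I :=
  ofContinuous I (fun _ => a) continuous_const

/-- The step function `t ↦ g [t c]`, where `[·]` is the integer part. -/
noncomputable def step (I : Set ℝ) (g : ℕ → ℝ) (c : ℕ) : CadlagFun I where
  toFun t := g ⌊(t : ℝ) * c⌋₊
  right_cont t := by
    have h1 : Tendsto (fun s : I => (s : ℝ) * c) (𝓝[≥] t) (𝓝[≥] ((t : ℝ) * c)) := by
      refine tendsto_nhdsWithin_iff.2 ⟨?_, ?_⟩
      · exact ((continuous_subtype_val.mul continuous_const).tendsto t).mono_left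
          nhdsWithin_le_nhds
      · filter_upwards [self_mem_nhdsWithin] with s hs
        exact mul_le_mul_of_nonneg_right (show (t : ℝ) ≤ s from hs) c.cast_nonneg
    have h2 := (tendsto_floor_right_pure_floor ((t : ℝ) * c)).comp h1
    rw [tendsto_pure] at h2
    refine tendsto_nhds_of_eventually_eq ?_
    filter_upwards [h2] with s hs
    simp only [Function.comp_apply] at hs
    rw [← Int.floor_toNat, hs, Int.floor_toNat]
  left_lim t := by
    rcases Nat.eq_zero_or_pos c with rfl | hc
    · exact ⟨g 0, by simpa using tendsto_const_nhds⟩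
    have h1 : Tendsto (fun s : I => (s : ℝ) * c) (𝓝[<] t) (𝓝[<] ((t : ℝ) * c)) := by
      refine tendsto_nhdsWithin_iff.2 ⟨?_, ?_⟩
      · exact ((continuous_subtype_val.mul continuous_const).tendsto t).mono_left
          nhdsWithin_le_nhds
      · filter_upwards [self_mem_nhdsWithin] with s hs
        exact mul_lt_mul_of_pos_right (show (s : ℝ) < t from hs) (Nat.cast_pos.2 hc)
    have h2 := (tendsto_floor_left_pure_ceil_sub_one ((t : ℝ) * c)).comp h1
    rw [tendsto_pure] at h2
    refine ⟨g (⌈(t : ℝ) * c⌉ - 1).toNat, tendsto_nhds_of_eventually_eq ?_⟩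
    filter_upwards [h2] with s hs
    simp only [Function.comp_apply] at hs
    rw [← Int.floor_toNat, hs]

end CadlagFun

/-! ### Perturbed Markov renewal processes -/

/-- The set `(0, ε₀]` of values of the perturbation parameter. -/
abbrev Pert (ε₀ : ℝ) : Type := Set.Ioc (0 : ℝ) ε₀

/-- The filter `ε → 0` on `(0, ε₀]`. -/
def toZero (ε₀ : ℝ) : Filter (Pert ε₀) := comap Subtype.val (𝓝[>] (0 : ℝ))

/-- One step from the state `i` has the law `Q i` of (next state, sojourn time, flag). The process
`(η n, κ n, ζ n)` is a Markov renewal process with these transition laws: a homogeneous Markov chain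
started with `κ 0 = 0`, `ζ 0 = 0`, whose next value depends on the past through `η n` only.
The initial distribution of `η 0` is arbitrary. -/
structure IsMarkovRenewal {m : ℕ} {Ω : Type*} [MeasurableSpace Ω] (P : Measure Ω)
    (Q : Kernel (Fin m) (Fin m × ℝ≥0 × Fin 2))
    (η : ℕ → Ω → Fin m) (κ : ℕ → Ω → ℝ≥0) (ζ : ℕ → Ω → Fin 2) : Prop where
  meas_state : ∀ n, Measurable (η n)
  meas_sojourn : ∀ n, Measurable (κ n)
  meas_flag : ∀ n, Measurable (ζ n)
  initial : ∀ᵐ ω ∂P, κ 0 ω = 0 ∧ ζ 0 ω = 0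
  markov : ∀ (n : ℕ) (H : Set Ω),
    MeasurableSet[⨆ k ≤ n, MeasurableSpace.comap (fun ω => (η k ω, κ k ω, ζ k ω)) inferInstance] H →
    ∀ (i : Fin m) (B : Set (Fin m × ℝ≥0 × Fin 2)), MeasurableSet B →
      P (H ∩ {ω | η n ω = i} ∩ {ω | (η (n + 1) ω, κ (n + 1) ω, ζ (n + 1) ω) ∈ B}) =
        P (H ∩ {ω | η n ω = i}) * Q i B

section Characteristics

variable {m : ℕ}

/-- Transition probabilities `p_{ij}` of the embedded Markov chain. -/
noncomputable def transProb (Q : Kernel (Fin m) (Fin m × ℝ≥0 × Fin 2)) (i j : Fin m) : ℝ :=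
  (Q i).real {z | z.1 = j}

/-- The probability `p_i` of the rare event during one step from the state `i`. -/
noncomputable def rareProb (Q : Kernel (Fin m) (Fin m × ℝ≥0 × Fin 2)) (i : Fin m) : ℝ :=
  (Q i).real {z | z.2.2 = 1}

/-- `w` is a stationary distribution for the matrix `p`. -/
def IsStationaryDist (p : Fin m → Fin m → ℝ) (w : Fin m → ℝ) : Prop :=
  (∀ i, 0 ≤ w i) ∧ (∀ i, w i = ∑ j, w j * p j i) ∧ ∑ i, w i = 1

/-- The stationary distribution `π_i` of the embedded Markov chain (it is unique when the chain is
ergodic). -/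
noncomputable def statDist (Q : Kernel (Fin m) (Fin m × ℝ≥0 × Fin 2)) : Fin m → ℝ :=
  Classical.epsilon (IsStationaryDist (transProb Q))

/-- `p = ∑ π_i p_i`. -/
noncomputable def avgRareProb (Q : Kernel (Fin m) (Fin m × ℝ≥0 × Fin 2)) : ℝ :=
  ∑ i, statDist Q i * rareProb Q i

/-- `v ∑ π_i f_i`, where `v = 1 / p`. -/
noncomputable def normFactor (Q : Kernel (Fin m) (Fin m × ℝ≥0 × Fin 2)) (f : Fin m → ℝ) : ℝ :=
  (avgRareProb Q)⁻¹ * ∑ i, statDist Q i * f i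

/-- Condition A: `0 < max_i p_{ε,i}` (for all small `ε`), and `max_i p_{ε,i} → 0` as `ε → 0`. -/
def CondA {ε₀ : ℝ} (Q : Pert ε₀ → Kernel (Fin m) (Fin m × ℝ≥0 × Fin 2)) : Prop :=
  (∀ᶠ ε in toZero ε₀, 0 < ⨆ i, rareProb (Q ε) i) ∧
    Tendsto (fun ε => ⨆ i, rareProb (Q ε) i) (toZero ε₀) (𝓝 0)

/-- Condition B: there is a ring chain `c 0, c 1, …, c N = c 0` through all the states with
`liminf_{ε → 0} p_{ε, c (k-1), c k} > 0` for `k = 1, …, N`. -/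
def CondB {ε₀ : ℝ} (Q : Pert ε₀ → Kernel (Fin m) (Fin m × ℝ≥0 × Fin 2)) : Prop :=
  ∃ (N : ℕ) (c : ℕ → Fin m), c N = c 0 ∧ (∀ i, ∃ k ≤ N, c k = i) ∧
    ∀ k < N, 0 < liminf (fun ε => transProb (Q ε) (c k) (c (k + 1))) (toZero ε₀)

/-- Condition H: `f_ε > 0` for all small `ε`. -/
def CondH {ε₀ : ℝ} (Q : Pert ε₀ → Kernel (Fin m) (Fin m × ℝ≥0 × Fin 2))
    (f : Pert ε₀ → Fin m → ℝ) : Prop :=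
  ∀ᶠ ε in toZero ε₀, 0 < normFactor (Q ε) (f ε)

/-- `f_ε → f₀` as `ε → 0`, where `f₀ ∈ [0, ∞]`. -/
def CondI {ε₀ : ℝ} (Q : Pert ε₀ → Kernel (Fin m) (Fin m × ℝ≥0 × Fin 2))
    (f : Pert ε₀ → Fin m → ℝ) (f₀ : ℝ≥0∞) : Prop :=
  Tendsto (fun ε => ENNReal.ofReal (normFactor (Q ε) (f ε))) (toZero ε₀) (𝓝 f₀)

end Characteristics

/-- The number `min {n ≥ 1 : ζ n = 1}` of steps up to the first rare event (`0` on the event that no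
rare event ever happens). -/
noncomputable def rareTime {Ω : Type*} (ζ : ℕ → Ω → Fin 2) (ω : Ω) : ℕ :=
  sInf {n : ℕ | 1 ≤ n ∧ ζ n ω = 1}

/-- The functional `ν(t) = ∑_{n=1}^{[tν]} f (η (n-1))`, where `ν` is the first-rare-event time. -/
noncomputable def rewardFun {m : ℕ} {Ω : Type*} (f : Fin m → ℝ) (η : ℕ → Ω → Fin m)
    (ζ : ℕ → Ω → Fin 2) (t : ℝ) (ω : Ω) : ℝ :=
  ∑ n ∈ Finset.Icc 1 ⌊t * rareTime ζ ω⌋₊, f (η (n - 1) ω)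

/-- The trajectory of `ν(t)`, `t ∈ I`, as an element of `D(I)`. -/
noncomputable def rewardPath {m : ℕ} {Ω : Type*} (I : Set ℝ) (f : Fin m → ℝ) (η : ℕ → Ω → Fin m)
    (ζ : ℕ → Ω → Fin 2) (ω : Ω) : CadlagFun I :=
  CadlagFun.step I (fun k => ∑ n ∈ Finset.Icc 1 k, f (η (n - 1) ω)) (rareTime ζ ω)

theorem rewardPath_apply {m : ℕ} {Ω : Type*} (I : Set ℝ) (f : Fin m → ℝ) (η : ℕ → Ω → Fin m)
    (ζ : ℕ → Ω → Fin 2) (ω : Ω) (t : I) :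
    (rewardPath I f η ζ ω).toFun t = rewardFun f η ζ t ω := rfl

/-! ### Stochastic matrices with a ring chain -/

/-! Everything reduces to one scalar. Write p for `avgRareProb`, ν for the rare-event time and Y =
pν. Two facts suffice: Y converges in law to an exponential variable with parameter 1, and f⁻¹ν(t),
where f is `normFactor`, is close to tY in probability, uniformly on bounded sets of t. The path is
thus compared with the line t ↦ tY on the same probability space, so no joint law is needed, and
convergence passes from Y to the path through the continuous map sending a slope to its line.

Both facts need estimates uniform in ε. Condition B supplies them: edges of the ring have
probability at least some δ > 0, which yields one constant C bounding the inverses of the stationary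
weights and the solutions of the Poisson equation h - Ph = g for centred g. That equation is used
twice.

With g = p - p_i, the function ψ = 1 + h satisfies Gψ = (1 - p + O(p²))ψ, where G is the
substochastic matrix of transitions without a rare event. Pairing ψ with the law of the chain before
the rare event gives P(ν > n) = (1 - p + O(p²))^n (1 + O(p)) for every initial distribution, and n ≈
y/p gives e^{-y}.

With g_i = f_i/∑πf - 1, the additive functional is a martingale plus boundary terms, so its second
moment is O(n). Over n ≈ u/p steps, p times the sum is O(√p) in L². Monotonicity in u makes this law
of large numbers uniform on bounded intervals, and u = tY can be substituted.

Necessity of condition I is compactness of [0, ∞]: every sequence has a subsequence along which f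
converges to some c, sufficiency identifies the limit as cν₀, and the law of cν₀ determines c. -/

theorem le_pow_mul_of_ring {α : Type*} {N : ℕ} {c : ℕ → α} (hN : c N = c 0)
    (hc : ∀ i, ∃ k ≤ N, c k = i) {B : ℝ} (hB : 1 ≤ B) {φ : α → ℝ} (hφ : ∀ i, 0 ≤ φ i)
    (h : ∀ k < N, φ (c (k + 1)) ≤ B * φ (c k)) (i j : α) : φ i ≤ B ^ (2 * N) * φ j := by
  have hstep : ∀ d k, k + d ≤ N → φ (c (k + d)) ≤ B ^ d * φ (c k) := by
    intro d
    induction d with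
    | zero => intro k _; simp
    | succ d ih =>
      intro k hk
      calc φ (c (k + d + 1)) ≤ B * φ (c (k + d)) := h _ (by omega)
        _ ≤ B * (B ^ d * φ (c k)) := by gcongr; exact ih k (by omega)
        _ = B ^ (d + 1) * φ (c k) := by ring
  obtain ⟨a, ha, rfl⟩ := hc i
  obtain ⟨b, hb, rfl⟩ := hc j
  -- Route from `c b` forward to the closing point `c N = c 0`, then on to `c a`: at most 2N edges.
  have h1 := hstep a 0 (by omega)
  have h2 := hstep (N - b) b (by omega)
  rw [Nat.add_sub_cancel' hb, hN] at h2
  rw [Nat.zero_add] at h1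
  calc φ (c a) ≤ B ^ a * φ (c 0) := h1
    _ ≤ B ^ a * (B ^ (N - b) * φ (c b)) := by gcongr
    _ = B ^ (a + (N - b)) * φ (c b) := by ring
    _ ≤ B ^ (2 * N) * φ (c b) := by
      refine mul_le_mul_of_nonneg_right (pow_le_pow_right₀ hB ?_) (hφ _)
      omega

/-- Reversing the ring swaps the direction of the edge inequality; this is the form satisfied by
stationary weights. -/
theorem le_pow_mul_of_ring_reverse {α : Type*} {N : ℕ} {c : ℕ → α} (hN : c N = c 0)
    (hc : ∀ i, ∃ k ≤ N, c k = i) {B : ℝ} (hB : 1 ≤ B) {φ : α → ℝ} (hφ : ∀ i, 0 ≤ φ i)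
    (h : ∀ k < N, φ (c k) ≤ B * φ (c (k + 1))) (i j : α) : φ i ≤ B ^ (2 * N) * φ j := by
  refine le_pow_mul_of_ring (c := fun k => c (N - k)) (by simp [hN]) ?_ hB hφ ?_ i j
  · intro i
    obtain ⟨k, hk, rfl⟩ := hc i
    exact ⟨N - k, by omega, by simp [Nat.sub_sub_self hk]⟩
  · intro k hk
    have := h (N - (k + 1)) (by omega)
    rwa [show N - (k + 1) + 1 = N - k by omega] at this

/-- A stochastic matrix whose transitions along a closed chain through all the states have
probabilities at least `δ`. -/
structure IsRingStochastic {m : ℕ} (p : Fin m → Fin m → ℝ) (N : ℕ) (c : ℕ → Fin m) (δ : ℝ) :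
    Prop where
  nonneg : ∀ i j, 0 ≤ p i j
  sum_eq_one : ∀ i, ∑ j, p i j = 1
  closed : c N = c 0
  cover : ∀ i, ∃ k ≤ N, c k = i
  edge : ∀ k < N, δ ≤ p (c k) (c (k + 1))

/-- The matrix `p` has the stationary distribution `w`, whose weights are at least `1 / C`, and the
Poisson equation `h - p h = g` with `w g = 0` has a solution with `‖h‖ ≤ C ‖g‖`. -/
structure IsPoissonBound {m : ℕ} (p : Fin m → Fin m → ℝ) (w : Fin m → ℝ) (C : ℝ) : Prop where
  stationary : IsStationaryDist p w
  one_le : 1 ≤ C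
  one_le_mul : ∀ i, 1 ≤ C * w i
  solve : ∀ g : Fin m → ℝ, ∑ i, w i * g i = 0 → ∃ h : Fin m → ℝ,
    (∀ i, h i - ∑ j, p i j * h j = g i) ∧ ∀ b, (∀ i, |g i| ≤ b) → ∀ i, |h i| ≤ C * b

/-- Constants are a right null vector of 1 - p, so a left null vector v exists. Entrywise |v| ≤
|v|p, and both sides have the same total mass, so |v| is itself invariant. -/
theorem exists_isStationaryDist {m : ℕ} [NeZero m] {p : Fin m → Fin m → ℝ}
    (hp : ∀ i j, 0 ≤ p i j) (hsum : ∀ i, ∑ j, p i j = 1) : ∃ w, IsStationaryDist p w := by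
  have hdet : (1 - Matrix.of p).det = 0 := by
    refine Matrix.exists_mulVec_eq_zero_iff.1 ⟨1, one_ne_zero, ?_⟩
    have : (Matrix.of p).mulVec 1 = 1 := by
      ext i
      simp [Matrix.mulVec, dotProduct, hsum]
    rw [Matrix.sub_mulVec, this, Matrix.one_mulVec, sub_self]
  obtain ⟨v, hv0, hv⟩ := Matrix.exists_vecMul_eq_zero_iff.2 hdet
  have hv1 : ∀ j, v j = ∑ i, v i * p i j := by
    intro j
    have := congrFun hv j
    simp only [Matrix.vecMul_sub, Matrix.vecMul_one, Pi.sub_apply, Pi.zero_apply] at this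
    rw [sub_eq_zero.1 this]
    simp [Matrix.vecMul, dotProduct]
  have hle : ∀ j, |v j| ≤ ∑ i, |v i| * p i j := by
    intro j
    rw [hv1 j]
    refine (Finset.abs_sum_le_sum_abs _ _).trans_eq (Finset.sum_congr rfl fun i _ => ?_)
    rw [abs_mul, abs_of_nonneg (hp i j)]
  have htot : ∑ j, |v j| = ∑ j, ∑ i, |v i| * p i j := by
    rw [Finset.sum_comm]
    simp_rw [← Finset.mul_sum, hsum, mul_one]
  have heq := (Finset.sum_eq_sum_iff_of_le fun j _ => hle j).1 htot
  have hpos : 0 < ∑ j, |v j| := by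
    obtain ⟨j, hj⟩ := Function.ne_iff.1 hv0
    exact Finset.sum_pos' (fun j _ => abs_nonneg _) ⟨j, Finset.mem_univ _, abs_pos.2 hj⟩
  refine ⟨fun i => |v i| / ∑ j, |v j|, fun i => by positivity, fun i => ?_, ?_⟩
  · beta_reduce
    rw [heq i (Finset.mem_univ _), Finset.sum_div]
    exact Finset.sum_congr rfl fun j _ => by ring
  · rw [← Finset.sum_div, div_self hpos.ne']

namespace IsRingStochastic

variable {m : ℕ} {p : Fin m → Fin m → ℝ} {N : ℕ} {c : ℕ → Fin m} {δ : ℝ}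

/-- A quantitative maximum principle: a state where h is near its maximum forces h to be near the
maximum at the next state of the ring. -/
theorem sub_le (hp : IsRingStochastic p N c δ) (hδ : 0 < δ) (hδ1 : δ ≤ 1) {h : Fin m → ℝ} {b : ℝ}
    (hb : ∀ i, |h i - ∑ j, p i j * h j| ≤ b) (i j : Fin m) :
    h i - h j ≤ (2 / δ) ^ (2 * N) * b := by
  have hb0 : 0 ≤ b := (abs_nonneg _).trans (hb i)
  have : Nonempty (Fin m) := ⟨i⟩
  obtain ⟨s, hs⟩ := Finite.exists_max h
  have hB : 1 ≤ 2 / δ := by rw [le_div_iff₀ hδ]; linarith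
  -- The summand b absorbs the defect of harmonicity: δφ(next) ≤ φ + δb ≤ 2φ because φ ≥ b and δ ≤
  -- 1, whence the factor 2/δ. The comparison is with the maximum point s, where φ = b.
  have key := le_pow_mul_of_ring hp.closed hp.cover hB (φ := fun i => h s - h i + b)
    (fun i => by have := hs i; linarith) (fun k hk => by
      have h1 : δ * (h s - h (c (k + 1))) ≤ ∑ j, p (c k) j * (h s - h j) :=
        (mul_le_mul_of_nonneg_right (hp.edge k hk) (sub_nonneg.2 (hs _))).trans
          (Finset.single_le_sum (f := fun j => p (c k) j * (h s - h j))
            (fun j _ => mul_nonneg (hp.nonneg _ _) (sub_nonneg.2 (hs _))) (Finset.mem_univ _))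
      have h2 : ∑ j, p (c k) j * (h s - h j) = h s - ∑ j, p (c k) j * h j := by
        simp_rw [mul_sub, Finset.sum_sub_distrib, ← Finset.sum_mul, hp.sum_eq_one, one_mul]
      have h3 := (abs_le.1 (hb (c k))).2
      have h4 := hs (c k)
      rw [div_mul_eq_mul_div, le_div_iff₀ hδ]
      nlinarith) j s
  simp only [sub_self, zero_add] at key
  have := hs i
  linarith

theorem isPoissonBound (hp : IsRingStochastic p N c δ) (hδ : 0 < δ) (hδ1 : δ ≤ 1)
    {w : Fin m → ℝ} (hw : IsStationaryDist p w) :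
    IsPoissonBound p w (m * (2 / δ) ^ (2 * N)) := by
  have hB : 1 ≤ 2 / δ := by rw [le_div_iff₀ hδ]; linarith
  have hm : (1 : ℝ) ≤ m := by exact_mod_cast (c 0).pos
  have hB' : 1 ≤ (2 / δ) ^ (2 * N) := one_le_pow₀ hB
  refine ⟨hw, one_le_mul_of_one_le_of_one_le hm hB', fun j => ?_, fun g hg => ?_⟩
  -- Stationary flow along an edge gives w(c k)δ ≤ w(c (k+1)), so all weights are comparable; as
  -- they sum to 1, none can be small.
  · have key := le_pow_mul_of_ring_reverse hp.closed hp.cover hB hw.1 (fun k hk => by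
      have h1 : w (c k) * δ ≤ w (c (k + 1)) := by
        rw [hw.2.1 (c (k + 1))]
        exact (mul_le_mul_of_nonneg_left (hp.edge k hk) (hw.1 _)).trans
          (Finset.single_le_sum (f := fun j => w j * p j (c (k + 1)))
            (fun j _ => mul_nonneg (hw.1 _) (hp.nonneg _ _)) (Finset.mem_univ _))
      have h2 := hw.1 (c k)
      have h3 := hw.1 (c (k + 1))
      rw [div_mul_eq_mul_div, le_div_iff₀ hδ]
      linarith)
    calc 1 = ∑ i, w i := hw.2.2.symm
      _ ≤ ∑ i : Fin m, (2 / δ) ^ (2 * N) * w j := Finset.sum_le_sum fun i _ => key i j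
      _ = m * (2 / δ) ^ (2 * N) * w j := by simp [mul_assoc]
  · have hws : ∀ h : Fin m → ℝ, ∑ i, w i * ∑ j, p i j * h j = ∑ j, w j * h j := by
      intro h
      simp_rw [Finset.mul_sum]
      rw [Finset.sum_comm]
      refine Finset.sum_congr rfl fun j _ => ?_
      rw [hw.2.1 j, Finset.sum_mul]
      exact Finset.sum_congr rfl fun i _ => by ring
    -- Adding the rank-one map h ↦ (w·h)1 removes the constants from the kernel of 1 - p. On centred
    -- data it changes nothing, since w·Th = w·h; injectivity comes from the oscillation bound and
    -- gives surjectivity by finite dimension.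
    let T : (Fin m → ℝ) →ₗ[ℝ] (Fin m → ℝ) :=
      { toFun := fun h i => h i - ∑ j, p i j * h j + ∑ j, w j * h j
        map_add' := fun h h' => by
          ext i
          simp only [Pi.add_apply, mul_add, Finset.sum_add_distrib]
          ring
        map_smul' := fun a h => by
          ext i
          simp only [Pi.smul_apply, smul_eq_mul, RingHom.id_apply, mul_left_comm _ a,
            ← Finset.mul_sum]
          ring }
    have hT : ∀ h i, T h i = h i - ∑ j, p i j * h j + ∑ j, w j * h j := fun _ _ => rfl
    have hwT : ∀ h, ∑ i, w i * T h i = ∑ j, w j * h j := by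
      intro h
      simp_rw [hT, mul_add, mul_sub, Finset.sum_add_distrib, Finset.sum_sub_distrib, hws,
        ← Finset.sum_mul, hw.2.2]
      ring
    have hosc : ∀ h : Fin m → ℝ, ∑ j, w j * h j = 0 → ∀ b, (∀ i, |T h i| ≤ b) →
        ∀ i, |h i| ≤ (2 / δ) ^ (2 * N) * b := by
      intro h h0 b hb i
      have hsub := hp.sub_le hδ hδ1 (h := h) (b := b) (fun i => by
        have := hb i
        rwa [hT, h0, add_zero] at this)
      have e1 : h i = ∑ j, w j * (h i - h j) := by
        simp_rw [mul_sub, Finset.sum_sub_distrib, ← Finset.sum_mul, hw.2.2, h0]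
        ring
      rw [e1]
      refine (Finset.abs_sum_le_sum_abs _ _).trans ?_
      calc ∑ j, |w j * (h i - h j)| ≤ ∑ j, w j * ((2 / δ) ^ (2 * N) * b) := by
            refine Finset.sum_le_sum fun j _ => ?_
            rw [abs_mul, abs_of_nonneg (hw.1 j)]
            refine mul_le_mul_of_nonneg_left (abs_le.2 ⟨?_, hsub i j⟩) (hw.1 j)
            have := hsub j i
            linarith
        _ = (2 / δ) ^ (2 * N) * b := by rw [← Finset.sum_mul, hw.2.2, one_mul]
    have hinj : Function.Injective T := by
      refine (injective_iff_map_eq_zero T).2 fun h hh => ?_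
      have h0 : ∑ j, w j * h j = 0 := by rw [← hwT, hh]; simp
      ext i
      have := hosc h h0 0 (fun i => by rw [hh]; simp) i
      simpa using this
    obtain ⟨h, hh⟩ := LinearMap.injective_iff_surjective.1 hinj g
    have h0 : ∑ j, w j * h j = 0 := by rw [← hwT, hh, hg]
    refine ⟨h, fun i => by rw [← hh, hT, h0, add_zero], fun b hb i => ?_⟩
    have hb0 : 0 ≤ b := (abs_nonneg _).trans (hb i)
    calc |h i| ≤ (2 / δ) ^ (2 * N) * b := hosc h h0 b (by rwa [hh]) i
      _ ≤ m * ((2 / δ) ^ (2 * N) * b) := le_mul_of_one_le_left (by positivity) hm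
      _ = m * (2 / δ) ^ (2 * N) * b := by ring

end IsRingStochastic

/-! ### Transition characteristics -/

section Characteristics

variable {m : ℕ} (Q : Kernel (Fin m) (Fin m × ℝ≥0 × Fin 2))

/-- The probability to go from `i` to `j` without a rare event. -/
noncomputable def quietProb (i j : Fin m) : ℝ := (Q i).real {z | z.1 = j ∧ z.2.2 ≠ 1}

theorem measurableSet_state_eq (j : Fin m) :
    MeasurableSet {z : Fin m × ℝ≥0 × Fin 2 | z.1 = j} :=
  measurable_fst (measurableSet_singleton j)

theorem measurableSet_flag_eq_one :
    MeasurableSet {z : Fin m × ℝ≥0 × Fin 2 | z.2.2 = 1} :=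
  (measurable_snd.comp measurable_snd) (measurableSet_singleton 1)

theorem transProb_nonneg (i j : Fin m) : 0 ≤ transProb Q i j := measureReal_nonneg

theorem rareProb_nonneg (i : Fin m) : 0 ≤ rareProb Q i := measureReal_nonneg

variable [IsMarkovKernel Q]

theorem sum_measureReal_inter_state (i : Fin m) {B : Set (Fin m × ℝ≥0 × Fin 2)}
    (hB : MeasurableSet B) : ∑ j, (Q i).real (B ∩ {z | z.1 = j}) = (Q i).real B := by
  rw [← measureReal_biUnion_finset]
  · congr 1
    ext z
    simp
  · intro a _ b _ hab
    refine Set.disjoint_left.2 fun z hz hz' => hab ?_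
    exact hz.2.symm.trans hz'.2
  · exact fun j _ => hB.inter (measurableSet_state_eq j)

theorem sum_transProb (i : Fin m) : ∑ j, transProb Q i j = 1 := by
  have := sum_measureReal_inter_state Q i MeasurableSet.univ
  simpa [transProb] using this

theorem quietProb_le_transProb (i j : Fin m) : quietProb Q i j ≤ transProb Q i j :=
  measureReal_mono fun _ hz => hz.1

theorem sum_transProb_sub_quietProb (i : Fin m) :
    ∑ j, (transProb Q i j - quietProb Q i j) = rareProb Q i := by
  rw [rareProb, ← sum_measureReal_inter_state Q i measurableSet_flag_eq_one]
  refine Finset.sum_congr rfl fun j _ => ?_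
  have := measureReal_inter_add_sdiff (μ := Q i) (s := {z : Fin m × ℝ≥0 × Fin 2 | z.1 = j})
    measurableSet_flag_eq_one
  rw [transProb, ← this, inter_comm]
  exact add_sub_cancel_right _ _

omit [IsMarkovKernel Q] in
-- Each state carries stationary weight at least 1/C, so no single p_i exceeds C times the average.
theorem rareProb_le {C : ℝ} (hC : IsPoissonBound (transProb Q) (statDist Q) C) (i : Fin m) :
    rareProb Q i ≤ C * avgRareProb Q := by
  have h1 : statDist Q i * rareProb Q i ≤ avgRareProb Q :=
    Finset.single_le_sum (f := fun i => statDist Q i * rareProb Q i)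
      (fun j _ => mul_nonneg (hC.stationary.1 j) (rareProb_nonneg Q j)) (Finset.mem_univ i)
  have h2 := hC.one_le_mul i
  have h3 := rareProb_nonneg Q i
  have h4 := hC.one_le
  calc rareProb Q i ≤ C * statDist Q i * rareProb Q i := le_mul_of_one_le_left h3 h2
    _ = C * (statDist Q i * rareProb Q i) := by ring
    _ ≤ C * avgRareProb Q := by gcongr

/-- A positive function `ψ` close to `1`, on which the substochastic matrix of the transitions
without rare events acts almost as the multiplication by `1 - p`. -/
theorem exists_quasi_eigenvector {C : ℝ} (hC : IsPoissonBound (transProb Q) (statDist Q) C)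
    (hsmall : 8 * C ^ 3 * avgRareProb Q ≤ 1) :
    ∃ ψ : Fin m → ℝ, (∀ i, |ψ i - 1| ≤ C ^ 2 * avgRareProb Q) ∧ ∀ i,
      (1 - avgRareProb Q - 4 * C ^ 3 * avgRareProb Q ^ 2) * ψ i ≤ ∑ j, quietProb Q i j * ψ j ∧
      ∑ j, quietProb Q i j * ψ j ≤
        (1 - avgRareProb Q + 4 * C ^ 3 * avgRareProb Q ^ 2) * ψ i := by
  set a := avgRareProb Q with ha
  have hC1 := hC.one_le
  have ha0 : 0 ≤ a := Finset.sum_nonneg fun j _ =>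
    mul_nonneg (hC.stationary.1 j) (rareProb_nonneg Q j)
  have hC2 : 1 ≤ C ^ 2 := one_le_pow₀ hC1
  have hC23 : C ^ 2 ≤ C ^ 3 := pow_le_pow_right₀ hC1 (by norm_num)
  -- The right-hand side is centred because `a` is the stationary mean of the p_i, and it is bounded
  -- by C a.
  obtain ⟨h, hh, hbound⟩ := hC.solve (fun i => a - rareProb Q i) (by
    simp_rw [mul_sub, Finset.sum_sub_distrib, ← Finset.sum_mul, hC.stationary.2.2]
    simp [ha, avgRareProb])
  have hb : ∀ i, |h i| ≤ C ^ 2 * a := by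
    intro i
    have := hbound (C * a) (fun i => abs_le.2 ⟨?_, ?_⟩) i
    · calc |h i| ≤ C * (C * a) := this
        _ = C ^ 2 * a := by ring
    · have := rareProb_le Q hC i
      linarith
    · have := rareProb_nonneg Q i
      nlinarith
  refine ⟨fun i => 1 + h i, fun i => by simpa using hb i, fun i => ?_⟩
  -- The part of Ph carried by rare transitions: total weight at most C a times |h| ≤ C² a, hence of
  -- second order.
  set e : ℝ := ∑ j, (transProb Q i j - quietProb Q i j) * h j with he
  have hsum : ∑ j, quietProb Q i j * (1 + h j) = 1 + h i - a - e := by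
    have h1 : ∑ j, quietProb Q i j = 1 - rareProb Q i := by
      have := sum_transProb_sub_quietProb Q i
      rw [Finset.sum_sub_distrib, sum_transProb] at this
      linarith
    have h2 : ∑ j, quietProb Q i j * h j = ∑ j, transProb Q i j * h j - e := by
      rw [he, ← Finset.sum_sub_distrib]
      exact Finset.sum_congr rfl fun j _ => by ring
    have h3 := hh i
    simp_rw [mul_add, mul_one, Finset.sum_add_distrib, h1, h2]
    linarith
  have hebound : |e| ≤ C ^ 3 * a ^ 2 := by
    calc |e| ≤ ∑ j, |(transProb Q i j - quietProb Q i j) * h j| :=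
          Finset.abs_sum_le_sum_abs _ _
      _ ≤ ∑ j, (transProb Q i j - quietProb Q i j) * (C ^ 2 * a) := by
          refine Finset.sum_le_sum fun j _ => ?_
          have := sub_nonneg.2 (quietProb_le_transProb Q i j)
          rw [abs_mul, abs_of_nonneg this]
          exact mul_le_mul_of_nonneg_left (hb j) this
      _ = rareProb Q i * (C ^ 2 * a) := by
          rw [← Finset.sum_mul, sum_transProb_sub_quietProb]
      _ ≤ C * a * (C ^ 2 * a) := by
          gcongr
          exact rareProb_le Q hC i
      _ = C ^ 3 * a ^ 2 := by ring
  have hah : |a * h i| ≤ C ^ 3 * a ^ 2 := by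
    rw [abs_mul, abs_of_nonneg ha0]
    calc a * |h i| ≤ a * (C ^ 2 * a) := by gcongr; exact hb i
      _ = C ^ 2 * a ^ 2 := by ring
      _ ≤ C ^ 3 * a ^ 2 := by gcongr
  -- From ψ ≥ 1/2 the additive error 2C³a² becomes the multiplicative one 4C³a²ψ.
  have hhalf : 1 / 2 ≤ 1 + h i := by
    have h1 := (abs_le.1 (hb i)).1
    have h2 : C ^ 2 * a ≤ C ^ 3 * a := by gcongr
    linarith
  have hbig : 2 * (C ^ 3 * a ^ 2) ≤ 4 * C ^ 3 * a ^ 2 * (1 + h i) := by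
    have : 0 ≤ C ^ 3 * a ^ 2 := by positivity
    nlinarith
  rw [hsum]
  have := abs_le.1 hebound
  have := abs_le.1 hah
  constructor <;> nlinarith

end Characteristics

/-! ### Markov renewal processes -/

namespace IsMarkovRenewal

variable {m : ℕ} {Ω : Type*} [MeasurableSpace Ω] {P : Measure Ω}
  {Q : Kernel (Fin m) (Fin m × ℝ≥0 × Fin 2)}
  {η : ℕ → Ω → Fin m} {κ : ℕ → Ω → ℝ≥0} {ζ : ℕ → Ω → Fin 2}

/-- The history of the process up to step `n`. -/
abbrev history (η : ℕ → Ω → Fin m) (κ : ℕ → Ω → ℝ≥0) (ζ : ℕ → Ω → Fin 2) (n : ℕ) :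
    MeasurableSpace Ω :=
  ⨆ k ≤ n, MeasurableSpace.comap (fun ω => (η k ω, κ k ω, ζ k ω)) inferInstance

theorem history_le (hX : IsMarkovRenewal P Q η κ ζ) (n : ℕ) :
    history η κ ζ n ≤ ‹MeasurableSpace Ω› :=
  iSup₂_le fun k _ => ((hX.meas_state k).prodMk
    ((hX.meas_sojourn k).prodMk (hX.meas_flag k))).comap_le

omit [MeasurableSpace Ω] in
theorem measurable_history {k n : ℕ} (hk : k ≤ n) :
    Measurable[history η κ ζ n] fun ω => (η k ω, κ k ω, ζ k ω) :=
  Measurable.of_comap_le (le_iSup₂_of_le k hk le_rfl)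

omit [MeasurableSpace Ω] in
theorem measurable_history_state {k n : ℕ} (hk : k ≤ n) : Measurable[history η κ ζ n] (η k) :=
  measurable_fst.comp (measurable_history (κ := κ) (ζ := ζ) hk)

omit [MeasurableSpace Ω] in
theorem measurable_history_flag {k n : ℕ} (hk : k ≤ n) : Measurable[history η κ ζ n] (ζ k) :=
  (measurable_snd.comp measurable_snd).comp (measurable_history (η := η) (κ := κ) hk)

/-! #### Second moments of additive functionals -/

/-- The Markov property as an identity of measures on the history σ-algebra, ready to be integrated
against history-measurable functions without conditional expectations. -/
theorem trim_restrict_eq [IsFiniteMeasure P] [IsMarkovKernel Q] (hX : IsMarkovRenewal P Q η κ ζ)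
    (n : ℕ) (i j : Fin m) :
    (P.restrict ({ω | η n ω = i} ∩ {ω | η (n + 1) ω = j})).trim (hX.history_le n) =
      ENNReal.ofReal (transProb Q i j) • (P.restrict {ω | η n ω = i}).trim (hX.history_le n) := by
  refine @Measure.ext _ (history η κ ζ n) _ _ fun H hH => ?_
  have hm : ∀ k i, MeasurableSet {ω | η k ω = i} := fun k i =>
    hX.meas_state k (measurableSet_singleton i)
  rw [Measure.smul_apply, trim_measurableSet_eq _ hH, trim_measurableSet_eq _ hH,
    Measure.restrict_apply (hX.history_le n H hH), Measure.restrict_apply (hX.history_le n H hH),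
    ← inter_assoc, smul_eq_mul, mul_comm, transProb, ofReal_measureReal]
  exact hX.markov n H hH i {z | z.1 = j} (measurableSet_state_eq j)

theorem setIntegral_eq [IsFiniteMeasure P] [IsMarkovKernel Q] (hX : IsMarkovRenewal P Q η κ ζ)
    {n : ℕ} {Z : Ω → ℝ} (hZ : StronglyMeasurable[history η κ ζ n] Z) (i j : Fin m) :
    ∫ ω in {ω | η n ω = i} ∩ {ω | η (n + 1) ω = j}, Z ω ∂P =
      transProb Q i j * ∫ ω in {ω | η n ω = i}, Z ω ∂P := by
  rw [integral_trim (hX.history_le n) hZ, hX.trim_restrict_eq, integral_smul_measure,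
    ← integral_trim (hX.history_le n) hZ, ENNReal.toReal_ofReal (transProb_nonneg Q i j),
    smul_eq_mul]

theorem integral_mul_eq [IsFiniteMeasure P] [IsMarkovKernel Q] (hX : IsMarkovRenewal P Q η κ ζ)
    {n : ℕ} {Z : Ω → ℝ} (hZ : StronglyMeasurable[history η κ ζ n] Z) (hZi : Integrable Z P)
    (φ : Fin m → Fin m → ℝ) :
    ∫ ω, Z ω * φ (η n ω) (η (n + 1) ω) ∂P =
      ∑ i, (∑ j, transProb Q i j * φ i j) * ∫ ω in {ω | η n ω = i}, Z ω ∂P := by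
  have hm : ∀ k i, MeasurableSet {ω | η k ω = i} := fun k i =>
    hX.meas_state k (measurableSet_singleton i)
  have h1 : ∀ ω, Z ω * φ (η n ω) (η (n + 1) ω) = ∑ i, ∑ j,
      ({ω | η n ω = i} ∩ {ω | η (n + 1) ω = j}).indicator (fun ω => φ i j * Z ω) ω := by
    intro ω
    rw [Finset.sum_eq_single (η n ω), Finset.sum_eq_single (η (n + 1) ω)]
    · simp [mul_comm]
    · intro j _ hj
      simp [hj.symm]
    · simp
    · intro i _ hi
      simp [hi.symm]
    · simp
  have hint : ∀ i j, Integrable (({ω | η n ω = i} ∩ {ω | η (n + 1) ω = j}).indicator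
      (fun ω => φ i j * Z ω)) P := fun i j =>
    (hZi.const_mul _).indicator ((hm n i).inter (hm (n + 1) j))
  simp_rw [h1]
  rw [integral_finsetSum _ fun i _ => integrable_finsetSum _ fun j _ => hint i j]
  refine Finset.sum_congr rfl fun i _ => ?_
  rw [integral_finsetSum _ fun j _ => hint i j, Finset.sum_mul]
  refine Finset.sum_congr rfl fun j _ => ?_
  rw [integral_indicator ((hm n i).inter (hm (n + 1) j)), integral_const_mul, hX.setIntegral_eq hZ]
  ring

/-- The martingale part of the additive functional of the embedded chain. -/
noncomputable def martPart (Q : Kernel (Fin m) (Fin m × ℝ≥0 × Fin 2)) (η : ℕ → Ω → Fin m)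
    (h : Fin m → ℝ) (n : ℕ) (ω : Ω) : ℝ :=
  ∑ k ∈ Finset.range n, (h (η (k + 1) ω) - ∑ j, transProb Q (η k ω) j * h j)

omit [MeasurableSpace Ω] in
theorem stronglyMeasurable_martPart (h : Fin m → ℝ) (n : ℕ) :
    StronglyMeasurable[history η κ ζ n] (martPart Q η h n) := by
  refine Measurable.stronglyMeasurable ?_
  refine Finset.measurable_fun_sum _ fun k hk => Measurable.sub ?_ ?_
  · exact (measurable_of_finite h).comp
      (measurable_history_state (κ := κ) (ζ := ζ) (Finset.mem_range.1 hk))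
  · exact (measurable_of_finite fun i => ∑ j, transProb Q i j * h j).comp
      (measurable_history_state (κ := κ) (ζ := ζ) (Finset.mem_range.1 hk).le)

theorem abs_sub_le [IsMarkovKernel Q] {h : Fin m → ℝ} {b : ℝ} (hb : ∀ i, |h i| ≤ b)
    (i j : Fin m) : |h j - ∑ k, transProb Q i k * h k| ≤ 2 * b := by
  have h1 : |∑ k, transProb Q i k * h k| ≤ b := by
    calc |∑ k, transProb Q i k * h k| ≤ ∑ k, |transProb Q i k * h k| :=
          Finset.abs_sum_le_sum_abs _ _
      _ ≤ ∑ k, transProb Q i k * b := by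
          refine Finset.sum_le_sum fun k _ => ?_
          rw [abs_mul, abs_of_nonneg (transProb_nonneg Q i k)]
          exact mul_le_mul_of_nonneg_left (hb k) (transProb_nonneg Q i k)
      _ = b := by rw [← Finset.sum_mul, sum_transProb, one_mul]
  have := abs_sub (h j) (∑ k, transProb Q i k * h k)
  have := hb j
  linarith

omit [MeasurableSpace Ω] in
theorem abs_martPart_le [IsMarkovKernel Q] {h : Fin m → ℝ} {b : ℝ} (hb : ∀ i, |h i| ≤ b)
    (n : ℕ) (ω : Ω) : |martPart Q η h n ω| ≤ n * (2 * b) := by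
  refine (Finset.abs_sum_le_sum_abs _ _).trans
    ((Finset.sum_le_sum fun k _ => abs_sub_le hb _ _).trans_eq ?_)
  simp

theorem integral_martPart_sq_le [IsProbabilityMeasure P] [IsMarkovKernel Q]
    (hX : IsMarkovRenewal P Q η κ ζ) {h : Fin m → ℝ} {b : ℝ} (hb : ∀ i, |h i| ≤ b) (n : ℕ) :
    ∫ ω, martPart Q η h n ω ^ 2 ∂P ≤ 4 * b ^ 2 * n := by
  induction n with
  | zero => simp [martPart]
  | succ n ih =>
    set φ : Fin m → Fin m → ℝ := fun i j => h j - ∑ k, transProb Q i k * h k with hφ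
    have hMm : ∀ n, Measurable (martPart Q η h n) := fun n =>
      ((stronglyMeasurable_martPart (κ := κ) (ζ := ζ) h n).measurable).mono
        (hX.history_le n) le_rfl
    have hMi : Integrable (martPart Q η h n) P :=
      Integrable.of_bound (hMm n).aestronglyMeasurable (n * (2 * b))
        (ae_of_all _ fun ω => abs_martPart_le hb n ω)
    have hM2i : ∀ n, Integrable (fun ω => martPart Q η h n ω ^ 2) P := fun n =>
      Integrable.of_bound ((hMm n).pow_const 2).aestronglyMeasurable ((n * (2 * b)) ^ 2)
        (ae_of_all _ fun ω => by
          rw [Real.norm_eq_abs, abs_pow]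
          exact pow_le_pow_left₀ (abs_nonneg _) (abs_martPart_le hb n ω) 2)
    have hφm : Measurable fun ω => φ (η n ω) (η (n + 1) ω) :=
      (measurable_of_finite (fun z : Fin m × Fin m => φ z.1 z.2)).comp
        ((hX.meas_state n).prodMk (hX.meas_state (n + 1)))
    have hci : Integrable (fun ω => martPart Q η h n ω * φ (η n ω) (η (n + 1) ω)) P :=
      hMi.mul_bdd (c := 2 * b) hφm.aestronglyMeasurable (ae_of_all _ fun ω => abs_sub_le hb _ _)
    -- Increments are centred given the past, hence orthogonal to the martingale.
    have hcross : ∫ ω, martPart Q η h n ω * φ (η n ω) (η (n + 1) ω) ∂P = 0 := by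
      rw [hX.integral_mul_eq (stronglyMeasurable_martPart h n) hMi]
      refine Finset.sum_eq_zero fun i _ => ?_
      simp_rw [hφ, mul_sub, Finset.sum_sub_distrib, ← Finset.sum_mul, sum_transProb]
      simp
    have hle : ∀ ω, martPart Q η h (n + 1) ω ^ 2 ≤ martPart Q η h n ω ^ 2 +
        2 * (martPart Q η h n ω * φ (η n ω) (η (n + 1) ω)) + 4 * b ^ 2 := by
      intro ω
      have h1 : martPart Q η h (n + 1) ω = martPart Q η h n ω + φ (η n ω) (η (n + 1) ω) := by
        rw [martPart, Finset.sum_range_succ]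
        rfl
      have h2 : φ (η n ω) (η (n + 1) ω) ^ 2 ≤ (2 * b) ^ 2 := by
        rw [← sq_abs]
        exact pow_le_pow_left₀ (abs_nonneg _) (abs_sub_le hb _ _) 2
      rw [h1]
      nlinarith
    calc ∫ ω, martPart Q η h (n + 1) ω ^ 2 ∂P
        ≤ ∫ ω, (martPart Q η h n ω ^ 2 +
          2 * (martPart Q η h n ω * φ (η n ω) (η (n + 1) ω)) + 4 * b ^ 2) ∂P :=
          integral_mono (hM2i (n + 1))
            (((hM2i n).add (hci.const_mul 2)).add (integrable_const _)) hle
      _ = ∫ ω, martPart Q η h n ω ^ 2 ∂P + 4 * b ^ 2 := by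
          rw [integral_add (f := fun ω => martPart Q η h n ω ^ 2 +
              2 * (martPart Q η h n ω * φ (η n ω) (η (n + 1) ω)))
              ((hM2i n).add (hci.const_mul 2)) (integrable_const _),
            integral_add (hM2i n) (hci.const_mul 2), integral_const_mul, hcross]
          simp
      _ ≤ 4 * b ^ 2 * (n + 1 : ℕ) := by
          push_cast
          linarith

/-- Chebyshev's inequality for the centred additive functionals of the embedded chain. -/
theorem measureReal_abs_sum_ge_le [IsProbabilityMeasure P] [IsMarkovKernel Q]
    (hX : IsMarkovRenewal P Q η κ ζ) {C : ℝ}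
    (hC : IsPoissonBound (transProb Q) (statDist Q) C) {g : Fin m → ℝ} {b : ℝ}
    (hg : ∑ i, statDist Q i * g i = 0) (hb : ∀ i, |g i| ≤ b) (n : ℕ) {a : ℝ} (ha : 0 < a) :
    P.real {ω | a ≤ |∑ k ∈ Finset.range n, g (η k ω)|} ≤ 8 * (C * b) ^ 2 * (n + 1) / a ^ 2 := by
  obtain ⟨h, hh, hbound⟩ := hC.solve g hg
  have hhb := hbound b hb
  have hS : ∀ ω, ∑ k ∈ Finset.range n, g (η k ω) =
      martPart Q η h n ω + h (η 0 ω) - h (η n ω) := by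
    intro ω
    have h1 : ∀ k, g (η k ω) = (h (η (k + 1) ω) - ∑ j, transProb Q (η k ω) j * h j) -
        (h (η (k + 1) ω) - h (η k ω)) := by
      intro k
      rw [← hh]
      ring
    rw [Finset.sum_congr rfl fun k _ => h1 k, Finset.sum_sub_distrib,
      Finset.sum_range_sub (fun k => h (η k ω)), martPart]
    ring
  have hMm : Measurable (martPart Q η h n) :=
    ((stronglyMeasurable_martPart (κ := κ) (ζ := ζ) h n).measurable).mono
      (hX.history_le n) le_rfl
  have hM2i : Integrable (fun ω => martPart Q η h n ω ^ 2) P :=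
    Integrable.of_bound (hMm.pow_const 2).aestronglyMeasurable ((n * (2 * (C * b))) ^ 2)
      (ae_of_all _ fun ω => by
        rw [Real.norm_eq_abs, abs_pow]
        exact pow_le_pow_left₀ (abs_nonneg _) (abs_martPart_le hhb n ω) 2)
  -- From (x + y)² ≤ 2x² + 2y² with x the martingale and y the boundary term, |y| ≤ 2Cb.
  have hmarkov := mul_meas_ge_le_integral_of_nonneg (μ := P)
    (f := fun ω => 2 * martPart Q η h n ω ^ 2 + 8 * (C * b) ^ 2)
    (ae_of_all _ fun ω => by simp only [Pi.zero_apply]; positivity)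
    ((hM2i.const_mul 2).add (integrable_const _)) (a ^ 2)
  rw [integral_add (hM2i.const_mul 2) (integrable_const _), integral_const_mul] at hmarkov
  have h2 := hX.integral_martPart_sq_le hhb n
  rw [le_div_iff₀ (by positivity), mul_comm]
  calc a ^ 2 * P.real {ω | a ≤ |∑ k ∈ Finset.range n, g (η k ω)|}
      ≤ a ^ 2 * P.real {ω | a ^ 2 ≤ 2 * martPart Q η h n ω ^ 2 + 8 * (C * b) ^ 2} := by
        refine mul_le_mul_of_nonneg_left (measureReal_mono fun ω hω => ?_) (sq_nonneg a)
        have h3 := pow_le_pow_left₀ ha.le (show a ≤ _ from hω) 2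
        rw [sq_abs, hS] at h3
        have h4 := abs_le.1 (hhb (η 0 ω))
        have h5 := abs_le.1 (hhb (η n ω))
        have h6 : (h (η 0 ω) - h (η n ω)) ^ 2 ≤ (2 * (C * b)) ^ 2 :=
          sq_le_sq' (by linarith) (by linarith)
        have h7 := sq_nonneg (martPart Q η h n ω - (h (η 0 ω) - h (η n ω)))
        show a ^ 2 ≤ 2 * martPart Q η h n ω ^ 2 + 8 * (C * b) ^ 2
        nlinarith
    _ ≤ 2 * ∫ ω, martPart Q η h n ω ^ 2 ∂P + 8 * (C * b) ^ 2 := by simpa using hmarkov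
    _ ≤ 8 * (C * b) ^ 2 * (n + 1) := by linarith

/-! #### The tail of the first-rare-event time -/

/-- The event that there are no rare events up to step `n`. -/
def quietUpTo (ζ : ℕ → Ω → Fin 2) (n : ℕ) : Set Ω := {ω | ∀ k, 1 ≤ k → k ≤ n → ζ k ω ≠ 1}

omit [MeasurableSpace Ω] in
theorem quietUpTo_zero : quietUpTo ζ 0 = univ := by
  ext ω
  simp only [quietUpTo, mem_ofPred_eq, mem_univ, iff_true]
  intro k h1 h2
  omega

omit [MeasurableSpace Ω] in
theorem quietUpTo_succ (n : ℕ) :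
    quietUpTo ζ (n + 1) = quietUpTo ζ n ∩ {ω | ζ (n + 1) ω ≠ 1} := by
  ext ω
  simp only [quietUpTo, mem_ofPred_eq, mem_inter_iff]
  constructor
  · exact fun h => ⟨fun k h1 h2 => h k h1 (by omega), h _ (by omega) le_rfl⟩
  · rintro ⟨h, h'⟩ k h1 h2
    rcases Nat.lt_or_eq_of_le h2 with h3 | rfl
    · exact h k h1 (by omega)
    · exact h'

omit [MeasurableSpace Ω] in
theorem measurableSet_quietUpTo (n : ℕ) :
    MeasurableSet[history η κ ζ n] (quietUpTo ζ n) := by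
  have : quietUpTo ζ n = ⋂ k, ⋂ (_ : 1 ≤ k), ⋂ (_ : k ≤ n), {ω | ζ k ω = 1}ᶜ := by
    ext ω
    simp [quietUpTo]
  rw [this]
  exact MeasurableSet.iInter fun k => MeasurableSet.iInter fun _ => MeasurableSet.iInter fun hk =>
    (measurable_history_flag (η := η) (κ := κ) hk (measurableSet_singleton 1)).compl

/-- The law of the state on the event that there are no rare events up to step `n`. -/
noncomputable def quietLaw (P : Measure Ω) (η : ℕ → Ω → Fin m) (ζ : ℕ → Ω → Fin 2) (n : ℕ)
    (i : Fin m) : ℝ :=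
  P.real (quietUpTo ζ n ∩ {ω | η n ω = i})

theorem sum_measureReal_inter [IsFiniteMeasure P] (hX : IsMarkovRenewal P Q η κ ζ) (n : ℕ)
    {B : Set Ω} (hB : MeasurableSet B) : ∑ i, P.real (B ∩ {ω | η n ω = i}) = P.real B := by
  rw [← measureReal_biUnion_finset]
  · congr 1
    ext ω
    simp
  · intro a _ b _ hab
    refine Set.disjoint_left.2 fun ω hω hω' => hab ?_
    exact hω.2.symm.trans hω'.2
  · exact fun i _ => hB.inter (hX.meas_state n (measurableSet_singleton i))

theorem sum_quietLaw [IsFiniteMeasure P] (hX : IsMarkovRenewal P Q η κ ζ) (n : ℕ) :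
    ∑ i, quietLaw P η ζ n i = P.real (quietUpTo ζ n) :=
  hX.sum_measureReal_inter n
    (hX.history_le n _ (measurableSet_quietUpTo (η := η) (κ := κ) n))

theorem quietLaw_succ [IsFiniteMeasure P] (hX : IsMarkovRenewal P Q η κ ζ) (n : ℕ) (j : Fin m) :
    quietLaw P η ζ (n + 1) j = ∑ i, quietLaw P η ζ n i * quietProb Q i j := by
  have hq : MeasurableSet {z : Fin m × ℝ≥0 × Fin 2 | z.1 = j ∧ z.2.2 ≠ 1} :=
    (measurableSet_state_eq j).inter measurableSet_flag_eq_one.compl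
  have hB : MeasurableSet (quietUpTo ζ (n + 1) ∩ {ω | η (n + 1) ω = j}) :=
    (hX.history_le _ _ (measurableSet_quietUpTo (η := η) (κ := κ) (n + 1))).inter
      (hX.meas_state (n + 1) (measurableSet_singleton j))
  rw [quietLaw, ← hX.sum_measureReal_inter n hB]
  refine Finset.sum_congr rfl fun i _ => ?_
  have := congrArg ENNReal.toReal (hX.markov n (quietUpTo ζ n)
    (measurableSet_quietUpTo n) i _ hq)
  rw [ENNReal.toReal_mul] at this
  refine Eq.trans ?_ this
  rw [Measure.real, quietUpTo_succ]
  congr 2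
  ext ω
  simp only [mem_inter_iff, mem_ofPred_eq]
  tauto

theorem sum_quietLaw_mul_succ [IsFiniteMeasure P] (hX : IsMarkovRenewal P Q η κ ζ)
    (ψ : Fin m → ℝ) (n : ℕ) :
    ∑ j, quietLaw P η ζ (n + 1) j * ψ j =
      ∑ i, quietLaw P η ζ n i * ∑ j, quietProb Q i j * ψ j := by
  simp_rw [hX.quietLaw_succ, Finset.sum_mul, Finset.mul_sum]
  rw [Finset.sum_comm]
  exact Finset.sum_congr rfl fun i _ => Finset.sum_congr rfl fun j _ => by ring

theorem sum_quietLaw_mul_le [IsFiniteMeasure P] (hX : IsMarkovRenewal P Q η κ ζ)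
    {ψ : Fin m → ℝ} {r : ℝ} (hr : 0 ≤ r) (hψ : ∀ i, ∑ j, quietProb Q i j * ψ j ≤ r * ψ i)
    (n : ℕ) : ∑ i, quietLaw P η ζ n i * ψ i ≤ r ^ n * ∑ i, quietLaw P η ζ 0 i * ψ i := by
  induction n with
  | zero => simp
  | succ n ih =>
    rw [hX.sum_quietLaw_mul_succ]
    calc ∑ i, quietLaw P η ζ n i * ∑ j, quietProb Q i j * ψ j
        ≤ ∑ i, quietLaw P η ζ n i * (r * ψ i) :=
          Finset.sum_le_sum fun i _ => mul_le_mul_of_nonneg_left (hψ i) measureReal_nonneg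
      _ = r * ∑ i, quietLaw P η ζ n i * ψ i := by
          rw [Finset.mul_sum]
          exact Finset.sum_congr rfl fun i _ => by ring
      _ ≤ r * (r ^ n * ∑ i, quietLaw P η ζ 0 i * ψ i) := by gcongr
      _ = _ := by ring

theorem le_sum_quietLaw_mul [IsFiniteMeasure P] (hX : IsMarkovRenewal P Q η κ ζ)
    {ψ : Fin m → ℝ} {r : ℝ} (hr : 0 ≤ r) (hψ : ∀ i, r * ψ i ≤ ∑ j, quietProb Q i j * ψ j)
    (n : ℕ) : r ^ n * ∑ i, quietLaw P η ζ 0 i * ψ i ≤ ∑ i, quietLaw P η ζ n i * ψ i := by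
  induction n with
  | zero => simp
  | succ n ih =>
    rw [hX.sum_quietLaw_mul_succ]
    calc r ^ (n + 1) * ∑ i, quietLaw P η ζ 0 i * ψ i
        = r * (r ^ n * ∑ i, quietLaw P η ζ 0 i * ψ i) := by ring
      _ ≤ r * ∑ i, quietLaw P η ζ n i * ψ i := by gcongr
      _ = ∑ i, quietLaw P η ζ n i * (r * ψ i) := by
          rw [Finset.mul_sum]
          exact Finset.sum_congr rfl fun i _ => by ring
      _ ≤ _ := Finset.sum_le_sum fun i _ => mul_le_mul_of_nonneg_left (hψ i) measureReal_nonneg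

/-- Each step multiplies the pairing of `quietLaw` with ψ by a factor between the two bases. Since ψ
is within C²p of 1, the pairing is the quiet probability up to that relative error; the initial law
enters only through this error. -/
theorem quietUpTo_bounds [IsProbabilityMeasure P] [IsMarkovKernel Q]
    (hX : IsMarkovRenewal P Q η κ ζ) {C : ℝ}
    (hC : IsPoissonBound (transProb Q) (statDist Q) C)
    (hsmall : 8 * C ^ 3 * avgRareProb Q ≤ 1) (n : ℕ) :
    (1 - avgRareProb Q - 4 * C ^ 3 * avgRareProb Q ^ 2) ^ n * (1 - C ^ 2 * avgRareProb Q) ≤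
        P.real (quietUpTo ζ n) * (1 + C ^ 2 * avgRareProb Q) ∧
      P.real (quietUpTo ζ n) * (1 - C ^ 2 * avgRareProb Q) ≤
        (1 - avgRareProb Q + 4 * C ^ 3 * avgRareProb Q ^ 2) ^ n *
          (1 + C ^ 2 * avgRareProb Q) := by
  obtain ⟨ψ, hψ1, hψ⟩ := exists_quasi_eigenvector Q hC hsmall
  set a := avgRareProb Q with ha
  have hC1 := hC.one_le
  have ha0 : 0 ≤ a := Finset.sum_nonneg fun j _ =>
    mul_nonneg (hC.stationary.1 j) (rareProb_nonneg Q j)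
  have hC3 : 1 ≤ C ^ 3 := one_le_pow₀ hC1
  have ha1 : a ≤ 1 / 8 := by nlinarith
  have hr : 0 ≤ 1 - a - 4 * C ^ 3 * a ^ 2 := by nlinarith
  have hr' : 0 ≤ 1 - a + 4 * C ^ 3 * a ^ 2 := by
    have : 0 ≤ 4 * C ^ 3 * a ^ 2 := by positivity
    linarith
  have hlo : ∀ n, P.real (quietUpTo ζ n) * (1 - C ^ 2 * a) ≤ ∑ i, quietLaw P η ζ n i * ψ i := by
    intro n
    rw [← hX.sum_quietLaw, Finset.sum_mul]
    refine Finset.sum_le_sum fun i _ => mul_le_mul_of_nonneg_left ?_ measureReal_nonneg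
    linarith [(abs_le.1 (hψ1 i)).1]
  have hhi : ∀ n, ∑ i, quietLaw P η ζ n i * ψ i ≤ P.real (quietUpTo ζ n) * (1 + C ^ 2 * a) := by
    intro n
    rw [← hX.sum_quietLaw, Finset.sum_mul]
    refine Finset.sum_le_sum fun i _ => mul_le_mul_of_nonneg_left ?_ measureReal_nonneg
    linarith [(abs_le.1 (hψ1 i)).2]
  have h0 : P.real (quietUpTo ζ 0) = 1 := by rw [quietUpTo_zero, probReal_univ]
  have hlo0 := hlo 0
  have hhi0 := hhi 0
  rw [h0, one_mul] at hlo0 hhi0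
  constructor
  · refine le_trans ?_ ((hX.le_sum_quietLaw_mul hr (fun i => (hψ i).1) n).trans (hhi n))
    gcongr
  · refine ((hlo n).trans (hX.sum_quietLaw_mul_le hr' (fun i => (hψ i).2) n)).trans ?_
    gcongr

omit [MeasurableSpace Ω] in
theorem lt_rareTime_subset (n : ℕ) : {ω | n < rareTime ζ ω} ⊆ quietUpTo ζ n := by
  intro ω hω k h1 h2 h3
  have : rareTime ζ ω ≤ k := Nat.sInf_le ⟨h1, h3⟩
  have : n < rareTime ζ ω := hω
  omega

omit [MeasurableSpace Ω] in
-- The default value `0` of `rareTime` loses the paths with no rare event at all; they form the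
-- extra intersection.
theorem quietUpTo_subset (n : ℕ) :
    quietUpTo ζ n ⊆ {ω | n < rareTime ζ ω} ∪ ⋂ k, quietUpTo ζ k := by
  intro ω hω
  by_cases h : ({n : ℕ | 1 ≤ n ∧ ζ n ω = 1}).Nonempty
  · left
    obtain ⟨h1, h2⟩ : 1 ≤ rareTime ζ ω ∧ ζ (rareTime ζ ω) ω = 1 := Nat.sInf_mem h
    by_contra h3
    exact hω _ h1 (not_lt.1 h3) h2
  · right
    refine mem_iInter.2 fun n k h1 _ h3 => h ⟨k, h1, h3⟩

theorem measurable_rareTime (hX : IsMarkovRenewal P Q η κ ζ) : Measurable (rareTime ζ) := by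
  have hm : ∀ n, MeasurableSet (quietUpTo ζ n) := fun n =>
    hX.history_le n _ (measurableSet_quietUpTo (η := η) (κ := κ) n)
  refine measurable_of_Ioi fun n => ?_
  have : rareTime ζ ⁻¹' Ioi n = quietUpTo ζ n \ ⋂ k, quietUpTo ζ k := by
    refine Subset.antisymm (fun ω hω => ⟨lt_rareTime_subset n hω, fun hall => ?_⟩) fun ω hω => ?_
    · have h1 : n < rareTime ζ ω := hω
      obtain ⟨h2, h3⟩ := Nat.sInf_mem (Nat.nonempty_of_pos_sInf (n.zero_le.trans_lt h1))
      exact mem_iInter.1 hall _ _ h2 le_rfl h3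
    · exact (quietUpTo_subset n hω.1).resolve_right hω.2
  rw [this]
  exact (hm n).diff (MeasurableSet.iInter hm)

/-- A rare event happens almost surely: for p > 0 the base of the geometric upper bound is below 1.
-/
theorem measureReal_lt_rareTime [IsProbabilityMeasure P] [IsMarkovKernel Q]
    (hX : IsMarkovRenewal P Q η κ ζ) {C : ℝ}
    (hC : IsPoissonBound (transProb Q) (statDist Q) C)
    (hsmall : 8 * C ^ 3 * avgRareProb Q ≤ 1) (hpos : 0 < avgRareProb Q) (n : ℕ) :
    P.real {ω | n < rareTime ζ ω} = P.real (quietUpTo ζ n) := by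
  refine le_antisymm (measureReal_mono (lt_rareTime_subset n)) ?_
  set a := avgRareProb Q with ha
  have hC1 := hC.one_le
  have hC3 : 1 ≤ C ^ 3 := one_le_pow₀ hC1
  have hC23 : C ^ 2 ≤ C ^ 3 := pow_le_pow_right₀ hC1 (by norm_num)
  have hnull : P.real (⋂ k, quietUpTo ζ k) = 0 := by
    have h1 : Tendsto (fun n : ℕ => (1 - a + 4 * C ^ 3 * a ^ 2) ^ n * (1 + C ^ 2 * a)) atTop
        (𝓝 (0 * (1 + C ^ 2 * a))) := by
      refine (tendsto_pow_atTop_nhds_zero_of_lt_one ?_ ?_).mul_const _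
      · have : a ≤ 1 / 8 := by nlinarith
        have : 0 ≤ 4 * C ^ 3 * a ^ 2 := by positivity
        linarith
      · nlinarith
    have h2 : P.real (⋂ k, quietUpTo ζ k) * (1 - C ^ 2 * a) ≤ 0 * (1 + C ^ 2 * a) :=
      ge_of_tendsto' h1 fun n => le_trans (by
        gcongr
        · nlinarith
        · exact measure_ne_top _ _
        · exact iInter_subset _ n) (hX.quietUpTo_bounds hC hsmall n).2
    have h3 : 0 < 1 - C ^ 2 * a := by nlinarith
    rw [zero_mul] at h2
    exact le_antisymm (nonpos_of_mul_nonpos_left h2 h3) measureReal_nonneg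
  calc P.real (quietUpTo ζ n) ≤ P.real ({ω | n < rareTime ζ ω} ∪ ⋂ k, quietUpTo ζ k) :=
        measureReal_mono (quietUpTo_subset n)
    _ ≤ P.real {ω | n < rareTime ζ ω} + P.real (⋂ k, quietUpTo ζ k) := measureReal_union_le _ _
    _ = P.real {ω | n < rareTime ζ ω} := by rw [hnull, add_zero]

end IsMarkovRenewal

/-! ### Asymptotics of the first-rare-event time and of additive functionals -/

theorem tendsto_one_sub_pow_exp {ι : Type*} {l : Filter ι} {x : ι → ℝ} {n : ι → ℕ} {y : ℝ}
    (hx : Tendsto x l (𝓝 0)) (hn : Tendsto (fun e => n e * x e) l (𝓝 y)) :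
    Tendsto (fun e => (1 - x e) ^ n e) l (𝓝 (Real.exp (-y))) := by
  have hlo : Tendsto (fun e => Real.exp (-(n e * x e / (1 - x e)))) l (𝓝 (Real.exp (-y))) := by
    refine (Real.continuous_exp.tendsto _).comp (Tendsto.neg ?_)
    simpa using! hn.div (hx.const_sub 1) (by norm_num)
  have hhi : Tendsto (fun e => Real.exp (-(n e * x e))) l (𝓝 (Real.exp (-y))) :=
    (Real.continuous_exp.tendsto _).comp hn.neg
  have hlt : ∀ᶠ e in l, x e < 1 := hx.eventually_lt_const one_pos
  refine tendsto_of_tendsto_of_tendsto_of_le_of_le' hlo hhi ?_ ?_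
  · filter_upwards [hlt] with e he
    have hpos : 0 < 1 - x e := by linarith
    have hlog : -(x e / (1 - x e)) ≤ Real.log (1 - x e) := by
      have := Real.one_sub_inv_le_log_of_pos hpos
      have h2 : 1 - (1 - x e)⁻¹ = -(x e / (1 - x e)) := by field_simp; ring
      rwa [h2] at this
    calc Real.exp (-(n e * x e / (1 - x e))) = Real.exp (n e * -(x e / (1 - x e))) := by
          congr 1; ring
      _ = Real.exp (-(x e / (1 - x e))) ^ n e := by rw [Real.exp_nat_mul]
      _ ≤ (1 - x e) ^ n e := by
          refine pow_le_pow_left₀ (Real.exp_nonneg _) ?_ _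
          rwa [← Real.le_log_iff_exp_le hpos]
  · filter_upwards [hlt] with e he
    calc (1 - x e) ^ n e ≤ Real.exp (-x e) ^ n e := by
          refine pow_le_pow_left₀ (by linarith) (Real.one_sub_le_exp_neg _) _
      _ = Real.exp (-(n e * x e)) := by
          rw [← Real.exp_nat_mul]
          congr 1
          ring

theorem abs_mul_floor_div_sub_le {a u : ℝ} (ha : 0 < a) (hu : 0 ≤ u) :
    |a * ⌊u / a⌋₊ - u| ≤ a := by
  have h1 := Nat.floor_le (div_nonneg hu ha.le)
  have h2 := Nat.lt_floor_add_one (u / a)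
  rw [le_div_iff₀ ha] at h1
  rw [div_lt_iff₀ ha] at h2
  exact abs_le.2 ⟨by linarith, by linarith⟩

theorem rewardFun_eq_sum_range {m : ℕ} {Ω : Type*} (f : Fin m → ℝ) (η : ℕ → Ω → Fin m)
    (ζ : ℕ → Ω → Fin 2) (t : ℝ) (ω : Ω) :
    rewardFun f η ζ t ω = ∑ k ∈ Finset.range ⌊t * rareTime ζ ω⌋₊, f (η k ω) := by
  rw [rewardFun, Finset.range_eq_Ico, Finset.sum_Ico_eq_sum_range, ← Finset.Ico_succ_right_eq_Icc,
    Finset.sum_Ico_eq_sum_range]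
  simp

theorem rewardFun_mono {m : ℕ} {Ω : Type*} {f : Fin m → ℝ} (hf : ∀ i, 0 ≤ f i)
    (η : ℕ → Ω → Fin m) (ζ : ℕ → Ω → Fin 2) (ω : Ω) : Monotone fun t => rewardFun f η ζ t ω := by
  intro s t hst
  simp only [rewardFun_eq_sum_range]
  refine Finset.sum_le_sum_of_subset_of_nonneg (Finset.range_mono (Nat.floor_mono ?_))
    fun _ _ _ => hf _
  gcongr

section Asymptotics

variable {ι : Type*} {l : Filter ι} {m : ℕ} {Q : ι → Kernel (Fin m) (Fin m × ℝ≥0 × Fin 2)}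
  [∀ e, IsMarkovKernel (Q e)] {Ω : ι → Type*} [∀ e, MeasurableSpace (Ω e)]
  {P : ∀ e, Measure (Ω e)} [∀ e, IsProbabilityMeasure (P e)]
  {η : ∀ e, ℕ → Ω e → Fin m} {κ : ∀ e, ℕ → Ω e → ℝ≥0} {ζ : ∀ e, ℕ → Ω e → Fin 2} {C : ℝ}

/-- The normalized first-rare-event time `p ν`. -/
noncomputable def scaledTime {m : ℕ} {Ω : Type*} (Q : Kernel (Fin m) (Fin m × ℝ≥0 × Fin 2))
    (ζ : ℕ → Ω → Fin 2) (ω : Ω) : ℝ :=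
  avgRareProb Q * rareTime ζ ω

theorem measurable_scaledTime {m : ℕ} {Ω : Type*} [MeasurableSpace Ω] {P : Measure Ω}
    {Q : Kernel (Fin m) (Fin m × ℝ≥0 × Fin 2)} {η : ℕ → Ω → Fin m} {κ : ℕ → Ω → ℝ≥0}
    {ζ : ℕ → Ω → Fin 2} (hX : IsMarkovRenewal P Q η κ ζ) : Measurable (scaledTime Q ζ) :=
  (measurable_from_top.comp hX.measurable_rareTime).const_mul _

/-- Both bases have the form 1 - a(1 + Da), and n = ⌊y/a⌋ gives na → y, so the second-order terms
contribute O(na²) → 0. -/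
theorem tendsto_measureReal_lt_scaledTime
    (hX : ∀ e, IsMarkovRenewal (P e) (Q e) (η e) (κ e) (ζ e))
    (hC : ∀ᶠ e in l, IsPoissonBound (transProb (Q e)) (statDist (Q e)) C)
    (ha : Tendsto (fun e => avgRareProb (Q e)) l (𝓝 0))
    (hpos : ∀ᶠ e in l, 0 < avgRareProb (Q e)) {y : ℝ} (hy : 0 ≤ y) :
    Tendsto (fun e => (P e).real {ω | y < scaledTime (Q e) (ζ e) ω}) l (𝓝 (Real.exp (-y))) := by
  set a := fun e => avgRareProb (Q e) with ha_def
  have hna : Tendsto (fun e => (⌊y / a e⌋₊ : ℝ) * a e) l (𝓝 y) := by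
    rw [tendsto_iff_dist_tendsto_zero]
    refine squeeze_zero' (Eventually.of_forall fun _ => dist_nonneg) ?_ ha
    filter_upwards [hpos] with e he
    rw [Real.dist_eq, mul_comm]
    exact abs_mul_floor_div_sub_le he hy
  have hone : ∀ D : ℝ, Tendsto (fun e => 1 + D * a e) l (𝓝 1) := fun D => by
    simpa using (ha.const_mul D).const_add 1
  have hpow : ∀ D : ℝ, Tendsto (fun e => (1 - a e * (1 + D * a e)) ^ ⌊y / a e⌋₊) l
      (𝓝 (Real.exp (-y))) := by
    intro D
    refine tendsto_one_sub_pow_exp (by simpa using ha.mul (hone D)) ?_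
    simpa [mul_assoc] using hna.mul (hone D)
  have hsmall : ∀ᶠ e in l, 8 * C ^ 3 * a e < 1 :=
    Tendsto.eventually_lt_const one_pos (by simpa using ha.const_mul (8 * C ^ 3))
  have hpos2 : ∀ᶠ e in l, 0 < 1 + -C ^ 2 * a e := (hone (-C ^ 2)).eventually_const_lt one_pos
  have hlo := ((hpow (4 * C ^ 3)).mul (hone (-C ^ 2))).div (hone (C ^ 2)) one_ne_zero
  have hhi := ((hpow (-(4 * C ^ 3))).mul (hone (C ^ 2))).div (hone (-C ^ 2)) one_ne_zero
  simp only [mul_one, div_one] at hlo hhi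
  have heq : ∀ᶠ e in l, (P e).real {ω | y < scaledTime (Q e) (ζ e) ω} =
      (P e).real (IsMarkovRenewal.quietUpTo (ζ e) ⌊y / a e⌋₊) := by
    filter_upwards [hC, hsmall, hpos] with e hCe hse hpe
    rw [← (hX e).measureReal_lt_rareTime hCe hse.le hpe]
    congr 1
    ext ω
    rw [mem_ofPred_eq, mem_ofPred_eq, Nat.floor_lt (div_nonneg hy hpe.le), div_lt_iff₀ hpe,
      scaledTime, mul_comm]
  refine tendsto_of_tendsto_of_tendsto_of_le_of_le' hlo hhi ?_ ?_
  · filter_upwards [heq, hC, hsmall, hpos] with e he hCe hse hpe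
    rw [he]
    have h1 : 0 < 1 + C ^ 2 * a e := by positivity
    simp only [Pi.div_apply]
    rw [div_le_iff₀ h1]
    refine le_trans (le_of_eq ?_) ((hX e).quietUpTo_bounds hCe hse.le _).1
    simp only [ha_def]
    ring_nf
  · filter_upwards [heq, hC, hsmall, hpos2] with e he hCe hse hpe
    rw [he]
    simp only [Pi.div_apply]
    rw [le_div_iff₀ hpe]
    refine le_trans (le_of_eq ?_) (((hX e).quietUpTo_bounds hCe hse.le ⌊y / a e⌋₊).2.trans (le_of_eq ?_))
    · simp only [ha_def]
      ring_nf
    · simp only [ha_def]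
      ring_nf

/-- Chebyshev over about u/a steps with a threshold of order δ/a leaves a probability O(a). -/
theorem tendsto_measureReal_abs_sum_sub
    (hX : ∀ e, IsMarkovRenewal (P e) (Q e) (η e) (κ e) (ζ e))
    (hC : ∀ᶠ e in l, IsPoissonBound (transProb (Q e)) (statDist (Q e)) C)
    {a : ι → ℝ} (ha : Tendsto a l (𝓝 0)) (hpos : ∀ᶠ e in l, 0 < a e)
    {g : ι → Fin m → ℝ} (hg0 : ∀ᶠ e in l, ∀ i, 0 ≤ g e i)
    (hg1 : ∀ᶠ e in l, ∑ i, statDist (Q e) i * g e i = 1) {u δ : ℝ} (hu : 0 ≤ u) (hδ : 0 < δ) :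
    Tendsto (fun e => (P e).real {ω |
      δ ≤ |a e * ∑ k ∈ Finset.range ⌊u / a e⌋₊, g e (η e k ω) - u|}) l (𝓝 0) := by
  have hlim : Tendsto (fun e => 32 * (C * C) ^ 2 / δ ^ 2 * ((u + a e) + a e) * a e) l (𝓝 0) := by
    simpa using (((ha.const_add u).add ha).const_mul (32 * (C * C) ^ 2 / δ ^ 2)).mul ha
  refine squeeze_zero' (Eventually.of_forall fun _ => measureReal_nonneg) ?_ hlim
  filter_upwards [hC, hpos, hg0, hg1, ha.eventually_lt_const (half_pos hδ)]
    with e hCe hae hg0e hg1e hsmall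
  set n := ⌊u / a e⌋₊ with hn
  have hfl := abs_le.1 (abs_mul_floor_div_sub_le hae hu)
  have hC1 := hCe.one_le
  -- The normalization ∑πg = 1 together with π_i ≥ 1/C bounds g by C, uniformly in the parameter.
  have hgC : ∀ i, g e i ≤ C := by
    intro i
    have h1 : statDist (Q e) i * g e i ≤ 1 := by
      rw [← hg1e]
      exact Finset.single_le_sum (f := fun i => statDist (Q e) i * g e i)
        (fun j _ => mul_nonneg (hCe.stationary.1 j) (hg0e j)) (Finset.mem_univ i)
    have h2 := hCe.one_le_mul i
    calc g e i ≤ C * statDist (Q e) i * g e i := le_mul_of_one_le_left (hg0e i) h2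
      _ = C * (statDist (Q e) i * g e i) := by ring
      _ ≤ C := mul_le_of_le_one_right (by linarith) h1
  have hcheb := (hX e).measureReal_abs_sum_ge_le hCe (g := fun i => g e i - 1) (b := C)
    (by simp_rw [mul_sub, Finset.sum_sub_distrib, mul_one, hg1e, hCe.stationary.2.2, sub_self])
    (fun i => abs_le.2 ⟨by linarith [hg0e i], by linarith [hgC i]⟩) n
    (a := δ / 2 / a e) (by positivity)
  refine le_trans (measureReal_mono fun ω hω => ?_) (hcheb.trans ?_)
  · have h1 : a e * ∑ k ∈ Finset.range n, g e (η e k ω) - u =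
        a e * ∑ k ∈ Finset.range n, (g e (η e k ω) - 1) + (a e * n - u) := by
      rw [Finset.sum_sub_distrib]
      simp only [Finset.sum_const, Finset.card_range, nsmul_eq_mul, mul_one]
      ring
    have h2 : δ ≤ |a e * ∑ k ∈ Finset.range n, g e (η e k ω) - u| := hω
    rw [h1] at h2
    have h3 := abs_add_le (a e * ∑ k ∈ Finset.range n, (g e (η e k ω) - 1)) (a e * n - u)
    rw [abs_mul, abs_of_pos hae] at h3
    have h4 : |a e * n - u| ≤ a e := abs_le.2 hfl
    rw [mem_ofPred_eq, div_le_iff₀ hae]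
    linarith
  · have h1 : 8 * (C * C) ^ 2 * ((n : ℝ) + 1) / (δ / 2 / a e) ^ 2 =
        32 * (C * C) ^ 2 / δ ^ 2 * (a e * n + a e) * a e := by
      field_simp
      ring
    rw [h1]
    gcongr
    linarith

/-- Uniform law of large numbers for the additive functionals of the embedded chains. -/
theorem tendsto_measureReal_exists_abs_sum_sub
    (hX : ∀ e, IsMarkovRenewal (P e) (Q e) (η e) (κ e) (ζ e))
    (hC : ∀ᶠ e in l, IsPoissonBound (transProb (Q e)) (statDist (Q e)) C)
    {a : ι → ℝ} (ha : Tendsto a l (𝓝 0)) (hpos : ∀ᶠ e in l, 0 < a e)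
    {g : ι → Fin m → ℝ} (hg0 : ∀ᶠ e in l, ∀ i, 0 ≤ g e i)
    (hg1 : ∀ᶠ e in l, ∑ i, statDist (Q e) i * g e i = 1) (K : ℝ) {δ : ℝ} (hδ : 0 < δ) :
    Tendsto (fun e => (P e).real {ω | ∃ u, 0 ≤ u ∧ u ≤ K ∧
      δ < |a e * ∑ k ∈ Finset.range ⌊u / a e⌋₊, g e (η e k ω) - u|}) l (𝓝 0) := by
  -- Grid of mesh δ/2. The rescaled sum is monotone in u, so errors below δ/2 at the two
  -- neighbouring grid points give an error at most δ between them.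
  set v : ℕ → ℝ := fun j => j * (δ / 2) with hv
  have hlim : Tendsto (fun e => ∑ j ∈ Finset.range (⌊K / (δ / 2)⌋₊ + 2), (P e).real {ω |
      δ / 2 ≤ |a e * ∑ k ∈ Finset.range ⌊v j / a e⌋₊, g e (η e k ω) - v j|}) l (𝓝 0) := by
    simpa using tendsto_finsetSum (Finset.range (⌊K / (δ / 2)⌋₊ + 2)) fun j _ =>
      tendsto_measureReal_abs_sum_sub hX hC ha hpos hg0 hg1 (u := v j) (by positivity)
        (half_pos hδ)
  refine squeeze_zero' (Eventually.of_forall fun _ => measureReal_nonneg) ?_ hlim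
  filter_upwards [hpos, hg0] with e hae hg0e
  refine le_trans (measureReal_mono ?_ (measure_ne_top _ _)) (measureReal_biUnion_finset_le _ _)
  rintro ω ⟨u, hu0, huK, hu⟩
  by_contra hcon
  simp only [mem_iUnion, mem_ofPred_eq, exists_prop, not_exists, not_and, not_le,
    Finset.mem_range] at hcon
  set F : ℝ → ℝ := fun u => a e * ∑ k ∈ Finset.range ⌊u / a e⌋₊, g e (η e k ω) with hF
  have hmono : Monotone F := by
    intro s t hst
    refine mul_le_mul_of_nonneg_left (Finset.sum_le_sum_of_subset_of_nonneg
      (Finset.range_mono (Nat.floor_mono ?_)) fun _ _ _ => hg0e _) hae.le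
    gcongr
  set j := ⌊u / (δ / 2)⌋₊ with hj
  have hjK : j ≤ ⌊K / (δ / 2)⌋₊ := Nat.floor_mono (by gcongr)
  have h1 : v j ≤ u := by
    have := Nat.floor_le (div_nonneg hu0 (half_pos hδ).le)
    rwa [le_div_iff₀ (half_pos hδ)] at this
  have h2 : u ≤ v (j + 1) := by
    have := Nat.lt_floor_add_one (u / (δ / 2))
    rw [div_lt_iff₀ (half_pos hδ)] at this
    simp only [hv]
    push_cast
    exact this.le
  have h3 : v (j + 1) = v j + δ / 2 := by
    simp only [hv]
    push_cast
    ring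
  have h4 := abs_lt.1 (hcon j (by omega))
  have h5 := abs_lt.1 (hcon (j + 1) (by omega))
  have h6 := hmono h1
  have h7 := hmono h2
  simp only [hF] at h6 h7
  refine hu.not_ge (abs_le.2 ⟨?_, ?_⟩) <;> linarith

/-- The normalized functional is close to `t p ν`, uniformly on bounded intervals. -/
theorem tendsto_measureReal_exists_abs_inv_mul_rewardFun_sub
    (hX : ∀ e, IsMarkovRenewal (P e) (Q e) (η e) (κ e) (ζ e))
    (hC : ∀ᶠ e in l, IsPoissonBound (transProb (Q e)) (statDist (Q e)) C)
    (ha : Tendsto (fun e => avgRareProb (Q e)) l (𝓝 0))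
    (hpos : ∀ᶠ e in l, 0 < avgRareProb (Q e)) {f : ι → Fin m → ℝ} (hf : ∀ e i, 0 ≤ f e i)
    (hfpos : ∀ᶠ e in l, 0 < normFactor (Q e) (f e)) (T : ℝ) {δ : ℝ} (hδ : 0 < δ) :
    Tendsto (fun e => (P e).real {ω | ∃ t, 0 ≤ t ∧ t ≤ T ∧
      δ < |(normFactor (Q e) (f e))⁻¹ * rewardFun (f e) (η e) (ζ e) t ω -
        t * scaledTime (Q e) (ζ e) ω|}) l (𝓝 0) := by
  set s : ι → ℝ := fun e => ∑ i, statDist (Q e) i * f e i with hs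
  have hspos : ∀ᶠ e in l, 0 < s e := by
    filter_upwards [hpos, hfpos] with e h1 h2
    exact (pos_iff_pos_of_mul_pos h2).1 (inv_pos.2 h1)
  refine (tendsto_order.2 ⟨fun r hr => Eventually.of_forall fun e => hr.trans_le measureReal_nonneg,
    fun r hr => ?_⟩)
  -- Off an event of probability below r/2, Y ≤ K, and then u = tY stays in [0, TK], where the
  -- uniform law of large numbers applies.
  obtain ⟨K, hK0, hK⟩ : ∃ K : ℝ, 0 ≤ K ∧ Real.exp (-K) < r / 2 :=
    ((eventually_ge_atTop 0).and ((Real.tendsto_exp_neg_atTop_nhds_zero).eventually_lt_const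
      (half_pos hr))).exists
  have h1 := (tendsto_measureReal_lt_scaledTime hX hC ha hpos hK0).eventually_lt_const hK
  have h2 := (tendsto_measureReal_exists_abs_sum_sub hX hC ha hpos
    (g := fun e i => f e i / s e)
    (hspos.mono fun e he i => div_nonneg (hf e i) he.le)
    (hspos.mono fun e he => by
      simp_rw [← mul_div_assoc, ← Finset.sum_div]
      exact div_self he.ne') (T * K) hδ).eventually_lt_const (half_pos hr)
  filter_upwards [h1, h2, hpos, hspos] with e h1e h2e hae hse
  refine lt_of_le_of_lt ((measureReal_mono ?_).trans (measureReal_union_le _ _))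
    ((add_lt_add h1e h2e).trans_eq (add_halves r))
  rintro ω ⟨t, ht0, htT, ht⟩
  by_cases hY : K < scaledTime (Q e) (ζ e) ω
  · exact Or.inl hY
  right
  have hY0 : 0 ≤ scaledTime (Q e) (ζ e) ω := mul_nonneg hae.le (Nat.cast_nonneg _)
  refine ⟨t * scaledTime (Q e) (ζ e) ω, by positivity, ?_, ?_⟩
  · exact mul_le_mul htT (not_lt.1 hY) hY0 (ht0.trans htT)
  · have e1 : t * scaledTime (Q e) (ζ e) ω / avgRareProb (Q e) = t * rareTime (ζ e) ω := by
      rw [scaledTime]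
      field_simp
    have e2 : avgRareProb (Q e) *
        ∑ k ∈ Finset.range ⌊t * rareTime (ζ e) ω⌋₊, f e (η e k ω) / s e =
        (normFactor (Q e) (f e))⁻¹ * rewardFun (f e) (η e) (ζ e) t ω := by
      rw [rewardFun_eq_sum_range, normFactor, ← Finset.sum_div, mul_inv, inv_inv]
      ring
    rw [e1, e2]
    exact ht

theorem tendsto_measureReal_exists_abs_rewardFun_sub
    (hX : ∀ e, IsMarkovRenewal (P e) (Q e) (η e) (κ e) (ζ e))
    (hC : ∀ᶠ e in l, IsPoissonBound (transProb (Q e)) (statDist (Q e)) C)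
    (ha : Tendsto (fun e => avgRareProb (Q e)) l (𝓝 0))
    (hpos : ∀ᶠ e in l, 0 < avgRareProb (Q e)) {f : ι → Fin m → ℝ} (hf : ∀ e i, 0 ≤ f e i)
    (hfpos : ∀ᶠ e in l, 0 < normFactor (Q e) (f e)) {c : ℝ}
    (hc : Tendsto (fun e => normFactor (Q e) (f e)) l (𝓝 c)) (T : ℝ) {δ : ℝ} (hδ : 0 < δ) :
    Tendsto (fun e => (P e).real {ω | ∃ t, 0 ≤ t ∧ t ≤ T ∧
      δ < |rewardFun (f e) (η e) (ζ e) t ω - t * (c * scaledTime (Q e) (ζ e) ω)|}) l (𝓝 0) := by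
  set M := |c| + 1 with hM
  have hM0 : 0 < M := by positivity
  refine (tendsto_order.2 ⟨fun r hr => Eventually.of_forall fun e => hr.trans_le measureReal_nonneg,
    fun r hr => ?_⟩)
  obtain ⟨K, hK0, hK⟩ : ∃ K : ℝ, 0 ≤ K ∧ Real.exp (-K) < r / 2 :=
    ((eventually_ge_atTop 0).and ((Real.tendsto_exp_neg_atTop_nhds_zero).eventually_lt_const
      (half_pos hr))).exists
  have h1 := (tendsto_measureReal_lt_scaledTime hX hC ha hpos hK0).eventually_lt_const hK
  have h2 := (tendsto_measureReal_exists_abs_inv_mul_rewardFun_sub hX hC ha hpos hf hfpos T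
    (δ := δ / 2 / M) (by positivity)).eventually_lt_const (half_pos hr)
  have h3 : ∀ᶠ e in l, normFactor (Q e) (f e) < M :=
    hc.eventually_lt_const ((le_abs_self c).trans_lt (lt_add_one _))
  have h4 : ∀ᶠ e in l, |normFactor (Q e) (f e) - c| * (T * K) < δ / 2 := by
    refine Tendsto.eventually_lt_const (half_pos hδ) (v := 0) ?_
    simpa using ((hc.sub_const c).abs).mul_const (T * K)
  filter_upwards [h1, h2, h3, h4, hpos, hfpos] with e h1e h2e h3e h4e hae hfe
  refine lt_of_le_of_lt ((measureReal_mono ?_).trans (measureReal_union_le _ _))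
    ((add_lt_add h1e h2e).trans_eq (add_halves r))
  rintro ω ⟨t, ht0, htT, ht⟩
  by_cases hY : K < scaledTime (Q e) (ζ e) ω
  · exact Or.inl hY
  right
  refine ⟨t, ht0, htT, ?_⟩
  have hY0 : 0 ≤ scaledTime (Q e) (ζ e) ω := mul_nonneg hae.le (Nat.cast_nonneg _)
  set Y := scaledTime (Q e) (ζ e) ω
  set F := normFactor (Q e) (f e)
  set R := rewardFun (f e) (η e) (ζ e) t ω
  -- The first term is the normalized error times a bounded factor; the second is small since F → c
  -- and tY ≤ TK.
  have e1 : R - t * (c * Y) = F * (F⁻¹ * R - t * Y) + (F - c) * (t * Y) := by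
    field_simp
    ring
  have e2 : |(F - c) * (t * Y)| ≤ |F - c| * (T * K) := by
    rw [abs_mul, abs_of_nonneg (mul_nonneg ht0 hY0)]
    exact mul_le_mul_of_nonneg_left (mul_le_mul htT (not_lt.1 hY) hY0 (ht0.trans htT))
      (abs_nonneg _)
  have e3 := abs_add_le (F * (F⁻¹ * R - t * Y)) ((F - c) * (t * Y))
  rw [← e1, abs_mul, abs_of_pos hfe] at e3
  have e4 : F * |F⁻¹ * R - t * Y| ≤ M * |F⁻¹ * R - t * Y| := by gcongr
  rw [div_lt_iff₀ hM0]
  linarith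

theorem tendsto_measureReal_rewardFun_le
    (hX : ∀ e, IsMarkovRenewal (P e) (Q e) (η e) (κ e) (ζ e))
    (hC : ∀ᶠ e in l, IsPoissonBound (transProb (Q e)) (statDist (Q e)) C)
    (ha : Tendsto (fun e => avgRareProb (Q e)) l (𝓝 0))
    (hpos : ∀ᶠ e in l, 0 < avgRareProb (Q e)) {f : ι → Fin m → ℝ} (hf : ∀ e i, 0 ≤ f e i)
    (hc : Tendsto (fun e => normFactor (Q e) (f e)) l atTop) {t : ℝ} (ht : 0 < t) (M : ℝ) :
    Tendsto (fun e => (P e).real {ω | rewardFun (f e) (η e) (ζ e) t ω ≤ M}) l (𝓝 0) := by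
  refine (tendsto_order.2 ⟨fun r hr => Eventually.of_forall fun e => hr.trans_le measureReal_nonneg,
    fun r hr => ?_⟩)
  -- The limit of P(Y ≤ s) is 1 - e^{-s} ≤ s = r/4 < r/2; on Y > s the normalized functional exceeds
  -- ts/2, which a large factor f pushes above M.
  set s := r / 4 with hs
  have hs0 : 0 < s := by positivity
  have hfpos := hc.eventually_gt_atTop 0
  have h1 := (tendsto_measureReal_lt_scaledTime hX hC ha hpos hs0.le).eventually_const_lt
    (u := 1 - r / 2) (by have := Real.one_sub_le_exp_neg s; linarith)
  set δ := s * t / 2 with hδ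
  have hδ0 : 0 < δ := by positivity
  have h2 := (tendsto_measureReal_exists_abs_inv_mul_rewardFun_sub hX hC ha hpos hf hfpos t
    hδ0).eventually_lt_const (half_pos hr)
  filter_upwards [h1, h2, hfpos, hc.eventually_gt_atTop (M / δ)] with e h1e h2e hfe hMe
  have hm : MeasurableSet {ω | s < scaledTime (Q e) (ζ e) ω} :=
    measurableSet_lt measurable_const (measurable_scaledTime (hX e))
  have hsub : {ω | rewardFun (f e) (η e) (ζ e) t ω ≤ M} ⊆
      {ω | s < scaledTime (Q e) (ζ e) ω}ᶜ ∪ {ω | ∃ t', 0 ≤ t' ∧ t' ≤ t ∧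
      δ < |(normFactor (Q e) (f e))⁻¹ * rewardFun (f e) (η e) (ζ e) t' ω -
        t' * scaledTime (Q e) (ζ e) ω|} := by
    intro ω hω
    by_contra hcon
    simp only [mem_union, not_or, mem_compl_iff, mem_ofPred_eq, not_exists, not_and,
      not_lt] at hcon hω
    have h3 := (abs_le.1 (hcon.2 t ht.le le_rfl)).1
    have h4 : t * s < t * scaledTime (Q e) (ζ e) ω := mul_lt_mul_of_pos_left (not_le.1 hcon.1) ht
    have h5 : δ < (normFactor (Q e) (f e))⁻¹ * rewardFun (f e) (η e) (ζ e) t ω := by linarith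
    rw [← div_eq_inv_mul, lt_div_iff₀ hfe] at h5
    rw [div_lt_iff₀ hδ0] at hMe
    linarith
  have h3 := (measureReal_mono hsub (measure_ne_top (P e) _)).trans (measureReal_union_le _ _)
  rw [probReal_compl_eq_one_sub hm] at h3
  linarith

end Asymptotics

/-! ### Criteria of convergence in distribution -/

theorem measureReal_map_Ioc {Ω : Type*} [MeasurableSpace Ω] {μ : Measure Ω}
    [IsProbabilityMeasure μ] {X : Ω → ℝ} (hX : AEMeasurable X μ) {a b : ℝ} (hab : a ≤ b) :
    (μ.map X).real (Ioc a b) = μ.real {ω | a < X ω} - μ.real {ω | b < X ω} := by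
  have h1 : ∀ y, μ.real {ω | y < X ω} = (μ.map X).real (Ioi y) := fun y =>
    (map_measureReal_apply_of_aemeasurable hX measurableSet_Ioi).symm
  have := Measure.isProbabilityMeasure_map hX
  rw [h1, h1, ← Ioi_sdiff_Ioi, measureReal_sdiff (Ioi_subset_Ioi hab) measurableSet_Ioi]

section WeakConvergence

variable {ι : Type*} {l : Filter ι} [l.IsCountablyGenerated] {Ω : ι → Type*}
  [∀ e, MeasurableSpace (Ω e)] {P : ∀ e, Measure (Ω e)} [∀ e, IsProbabilityMeasure (P e)]
  {Ω₀ : Type*} [MeasurableSpace Ω₀] {P₀ : Measure Ω₀} [IsProbabilityMeasure P₀]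

/-- Tails determine the probabilities of half-open intervals, a π-system containing arbitrarily
small neighbourhoods of every point. -/
theorem tendstoInDistribution_of_tendsto_measureReal_gt {Y : ∀ e, Ω e → ℝ} {Z : Ω₀ → ℝ}
    (hY : ∀ e, AEMeasurable (Y e) (P e)) (hZ : AEMeasurable Z P₀)
    (h : ∀ y, Tendsto (fun e => (P e).real {ω | y < Y e ω}) l (𝓝 (P₀.real {ω | y < Z ω}))) :
    TendstoInDistribution Y l Z P P₀ where
  forall_aemeasurable := hY
  aemeasurable_limit := hZ
  tendsto := by
    refine IsPiSystem.tendsto_probabilityMeasure_of_tendsto_of_mem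
      (S := {s | ∃ a b, a ≤ b ∧ s = Ioc a b}) ?_ ?_ ?_ ?_
    · rintro _ ⟨a, b, hab, rfl⟩ _ ⟨c, d, hcd, rfl⟩ hne
      rw [Ioc_inter_Ioc] at hne ⊢
      exact ⟨_, _, (nonempty_Ioc.1 hne).le, rfl⟩
    · rintro _ ⟨a, b, hab, rfl⟩
      exact measurableSet_Ioc
    · intro u hu x hx
      obtain ⟨r, hr, hru⟩ := Metric.isOpen_iff.1 hu x hx
      refine ⟨Ioc (x - r / 2) (x + r / 2), ⟨_, _, by linarith, rfl⟩,
        Ioc_mem_nhds (by linarith) (by linarith), fun y hy => hru ?_⟩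
      rw [Metric.mem_ball, Real.dist_eq, abs_lt]
      constructor <;> linarith [hy.1, hy.2]
    · rintro _ ⟨a, b, hab, rfl⟩
      rw [← NNReal.tendsto_coe]
      have h1 := (h a).sub (h b)
      rw [← measureReal_map_Ioc hZ hab] at h1
      exact h1.congr fun e => (measureReal_map_Ioc (hY e) hab).symm

/-- If `X e` belongs with probability tending to one to the neighbourhoods `V n (Y e)` of
`L (Y e)`, and `Y e` converges in distribution to `Z`, then `X e` converges in distribution to
`L Z`. -/
theorem TendstoInDistribution.of_tendsto_measureReal_notMem {E : Type*} [TopologicalSpace E]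
    [MeasurableSpace E] [BorelSpace E] {X : ∀ e, Ω e → E} {Y : ∀ e, Ω e → ℝ} {Z : Ω₀ → ℝ}
    {L : ℝ → E} (hL : Continuous L) (hX : ∀ e, AEMeasurable (X e) (P e))
    (hY : TendstoInDistribution Y l Z P P₀) {V : ℕ → ℝ → Set E}
    (hmono : ∀ n k a, n ≤ k → V k a ⊆ V n a)
    (hV : ∀ U, IsOpen U → ∀ a, L a ∈ U → ∃ n, ∀ᶠ b in 𝓝 a, V n b ⊆ U)
    (hclose : ∀ n, Tendsto (fun e => (P e).real {ω | X e ω ∉ V n (Y e ω)}) l (𝓝 0)) :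
    TendstoInDistribution X l (fun ω => L (Z ω)) P P₀ where
  forall_aemeasurable := hX
  aemeasurable_limit := hL.measurable.comp_aemeasurable hY.aemeasurable_limit
  tendsto := by
    have hZ := hY.aemeasurable_limit
    refine tendsto_of_forall_isOpen_le_liminf' fun U hU => ?_
    -- If Y ∈ A n and X ∈ V n Y, then X ∈ U. The open sets A n increase and cover L⁻¹U, so the
    -- portmanteau bound for Y on each A n gives the one for X on U. No metric on E is needed.
    set A : ℕ → Set ℝ := fun n => interior {b | V n b ⊆ U} with hA
    have hAmono : Monotone A := fun n k hnk =>
      interior_mono fun b hb => (hmono n k b hnk).trans hb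
    have hcover : L ⁻¹' U ⊆ ⋃ n, A n := fun a ha => by
      obtain ⟨n, hn⟩ := hV U hU a ha
      exact mem_iUnion.2 ⟨n, mem_interior_iff_mem_nhds.2 hn⟩
    simp only [ProbabilityMeasure.coe_mk]
    have hbound : ∀ n, (P₀.map Z) (A n) ≤ liminf (fun e => ((P e).map (X e)) U) l := by
      intro n
      have h1 := ProbabilityMeasure.le_liminf_measure_open_of_tendsto hY.tendsto
        (isOpen_interior (s := {b | V n b ⊆ U}))
      simp only [ProbabilityMeasure.coe_mk] at h1
      have h2 : Tendsto (fun e => (P e) {ω | X e ω ∉ V n (Y e ω)}) l (𝓝 0) := by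
        rw [← ENNReal.tendsto_toReal_iff (fun _ => measure_ne_top _ _) ENNReal.zero_ne_top]
        exact hclose n
      calc (P₀.map Z) (A n) ≤ liminf (fun e => ((P e).map (Y e)) (A n)) l := h1
        _ ≤ liminf (fun e => ((P e).map (X e)) U + (P e) {ω | X e ω ∉ V n (Y e ω)}) l := by
            refine liminf_le_liminf (Eventually.of_forall fun e => ?_)
            rw [Measure.map_apply_of_aemeasurable (hY.forall_aemeasurable e)
              isOpen_interior.measurableSet,
              Measure.map_apply_of_aemeasurable (hX e) hU.measurableSet]
            refine (measure_mono fun ω hω => ?_).trans (measure_union_le _ _)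
            by_cases hmem : X e ω ∈ V n (Y e ω)
            · exact Or.inl (interior_subset (s := {b | V n b ⊆ U}) hω hmem)
            · exact Or.inr hmem
        _ = liminf (fun e => ((P e).map (X e)) U) l :=
            ENNReal.liminf_add_of_right_tendsto_zero h2 _
    rw [← Function.comp_def L Z, ← AEMeasurable.map_map_of_aemeasurable
      hL.measurable.aemeasurable hZ, Measure.map_apply hL.measurable hU.measurableSet]
    refine (measure_mono hcover).trans ?_
    rw [hAmono.measure_iUnion]
    exact iSup_le hbound

end WeakConvergence

/-! ### Continuity and measurability in the Skorokhod space -/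

namespace CadlagFun

variable {I : Set ℝ}

theorem exists_jBall_subset {U : Set (CadlagFun I)} (hU : IsOpen U) {x : CadlagFun I}
    (hx : x ∈ U) : ∃ K : Set I, IsCompact K ∧ ∃ δ : ℝ, 0 < δ ∧ x.jBall K δ ⊆ U :=
  hU x hx

/-- The identity time change is enough here, since all the limit paths are continuous. -/
theorem mem_jBall_of_forall_abs_lt {x y : CadlagFun I} {K : Set I} {δ : ℝ} (hδ : 0 < δ)
    (h : ∀ s ∈ K, |y.toFun s - x.toFun s| < δ) : y ∈ x.jBall K δ :=
  ⟨OrderIso.refl I, fun s hs => ⟨by simpa using hδ, h s hs⟩⟩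

theorem exists_forall_abs_le {K : Set I} (hK : IsCompact K) :
    ∃ R : ℝ, 0 < R ∧ ∀ s ∈ K, |(s : ℝ)| ≤ R := by
  obtain ⟨R, hR⟩ := hK.exists_bound_of_continuousOn
    (continuous_subtype_val (p := fun x => x ∈ I)).continuousOn
  exact ⟨max R 1, by positivity, fun s hs => (hR s hs).trans (le_max_left _ _)⟩

theorem continuous_linear (I : Set ℝ) : Continuous (linear I) := by
  refine continuous_def.2 fun U hU => isOpen_iff_mem_nhds.2 fun a ha => ?_
  obtain ⟨K, hK, δ, hδ, hsub⟩ := exists_jBall_subset hU ha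
  obtain ⟨R, hR, hKR⟩ := exists_forall_abs_le hK
  filter_upwards [Metric.ball_mem_nhds a (div_pos hδ hR)] with b hb
  refine hsub (mem_jBall_of_forall_abs_lt hδ fun s hs => ?_)
  rw [Metric.mem_ball, Real.dist_eq, lt_div_iff₀ hR] at hb
  calc |(s : ℝ) * b - s * a| = |(s : ℝ)| * |b - a| := by rw [← mul_sub, abs_mul]
    _ ≤ R * |b - a| := by gcongr; exact hKR s hs
    _ < δ := by linarith

/-- A function of a sequence and a natural number with values in `D(I)` is continuous if, on every
compact set, it depends on finitely many terms of the sequence only. -/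
theorem continuous_of_forall_eqOn {α : Type*} [TopologicalSpace α] [DiscreteTopology α]
    {F : (ℕ → α) × ℕ → CadlagFun I}
    (hF : ∀ c, ∀ K : Set I, IsCompact K → ∃ n : ℕ, ∀ s s' : ℕ → α, (∀ k ≤ n, s k = s' k) →
      ∀ t ∈ K, (F (s, c)).toFun t = (F (s', c)).toFun t) : Continuous F := by
  refine continuous_def.2 fun U hU => isOpen_iff_mem_nhds.2 fun ⟨s, c⟩ ha => ?_
  obtain ⟨K, hK, δ, hδ, hsub⟩ := exists_jBall_subset hU ha
  obtain ⟨n, hn⟩ := hF c K hK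
  have h1 : ∀ᶠ z : (ℕ → α) × ℕ in 𝓝 (s, c), ∀ k ∈ Finset.range (n + 1), z.1 k = s k := by
    refine (Finset.eventually_all _).2 fun k _ => ?_
    have : Continuous fun z : (ℕ → α) × ℕ => z.1 k := (continuous_apply k).comp continuous_fst
    exact (this.tendsto (s, c)).eventually ((isOpen_discrete {s k}).mem_nhds rfl)
  have h2 : ∀ᶠ z : (ℕ → α) × ℕ in 𝓝 (s, c), z.2 = c := by
    have : Tendsto (fun z : (ℕ → α) × ℕ => z.2) (𝓝 (s, c)) (𝓝 c) := continuous_snd.tendsto _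
    exact this.eventually ((isOpen_discrete {c}).mem_nhds rfl)
  filter_upwards [h1, h2] with z hz1 hz2
  obtain ⟨s', c'⟩ := z
  subst hz2
  refine hsub (mem_jBall_of_forall_abs_lt hδ fun t ht => ?_)
  rw [hn s' s (fun k hk => hz1 k (Finset.mem_range.2 (by omega))) t ht, sub_self, abs_zero]
  exact hδ

end CadlagFun

/-- Yields Borel measurability of the paths without describing the Borel sets of the J-topology: a
path is a continuous function of the state sequence and the rare-event time, which range over a
product of discrete spaces. -/
theorem continuous_map_step {m : ℕ} (I : Set ℝ) (f : Fin m → ℝ) {φ : ℝ → ℝ} (hφ : Continuous φ) :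
    Continuous fun z : (ℕ → Fin m) × ℕ =>
      (CadlagFun.step I (fun k => ∑ n ∈ Finset.Icc 1 k, f (z.1 (n - 1))) z.2).map φ hφ := by
  refine CadlagFun.continuous_of_forall_eqOn fun c K hK => ?_
  obtain ⟨R, hR, hKR⟩ := CadlagFun.exists_forall_abs_le hK
  refine ⟨⌊R * c⌋₊, fun s s' hs t ht => ?_⟩
  change φ (∑ n ∈ Finset.Icc 1 ⌊(t : ℝ) * c⌋₊, f (s (n - 1))) =
    φ (∑ n ∈ Finset.Icc 1 ⌊(t : ℝ) * c⌋₊, f (s' (n - 1)))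
  refine congrArg φ (Finset.sum_congr rfl fun n hn => congrArg f (hs _ ?_))
  have h1 : ⌊(t : ℝ) * c⌋₊ ≤ ⌊R * c⌋₊ := by
    refine Nat.floor_mono ?_
    gcongr
    exact (le_abs_self _).trans (hKR t ht)
  have := (Finset.mem_Icc.1 hn).2
  omega

theorem measurable_map_rewardPath {m : ℕ} {Ω : Type*} [MeasurableSpace Ω] {P : Measure Ω}
    {Q : Kernel (Fin m) (Fin m × ℝ≥0 × Fin 2)} {η : ℕ → Ω → Fin m} {κ : ℕ → Ω → ℝ≥0}
    {ζ : ℕ → Ω → Fin 2} (hX : IsMarkovRenewal P Q η κ ζ) (I : Set ℝ) (f : Fin m → ℝ) {φ : ℝ → ℝ}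
    (hφ : Continuous φ) : Measurable fun ω => (rewardPath I f η ζ ω).map φ hφ := by
  have hpair : Measurable fun ω => ((fun n => η n ω : ℕ → Fin m), rareTime ζ ω) :=
    (measurable_pi_lambda _ hX.meas_state).prodMk hX.measurable_rareTime
  have hmeas := (continuous_map_step I f hφ).measurable
  have h := hmeas.comp hpair
  exact h

/-! ### Limit laws -/

section Exponential

variable {Ω₀ : Type*} [MeasurableSpace Ω₀] {P₀ : Measure Ω₀} [IsProbabilityMeasure P₀] {ν₀ : Ω₀ → ℝ}

omit [IsProbabilityMeasure P₀] in
theorem measureReal_lt_of_hasLaw_expMeasure (hν₀ : HasLaw ν₀ (expMeasure 1) P₀) (y : ℝ) :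
    P₀.real {ω | y < ν₀ ω} = if 0 ≤ y then Real.exp (-y) else 1 := by
  have := isProbabilityMeasure_expMeasure one_pos
  have h1 : P₀.real {ω | y < ν₀ ω} = (expMeasure 1).real (Ioi y) := by
    rw [← hν₀.map_eq, map_measureReal_apply_of_aemeasurable hν₀.aemeasurable measurableSet_Ioi]
    rfl
  rw [h1, ← compl_Iic, probReal_compl_eq_one_sub measurableSet_Iic, ← cdf_eq_real,
    cdf_expMeasure_eq one_pos]
  split_ifs <;> simp

theorem ae_pos_of_hasLaw_expMeasure (hν₀ : HasLaw ν₀ (expMeasure 1) P₀) :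
    ∀ᵐ ω ∂P₀, 0 < ν₀ ω := by
  have h1 := measureReal_lt_of_hasLaw_expMeasure hν₀ 0
  simp only [le_refl, if_true, neg_zero, Real.exp_zero] at h1
  have hm : NullMeasurableSet {ω | 0 < ν₀ ω} P₀ :=
    nullMeasurableSet_lt aemeasurable_const hν₀.aemeasurable
  rw [ae_iff]
  change P₀ {ω | 0 < ν₀ ω}ᶜ = 0
  rw [prob_compl_eq_zero_iff₀ hm, ← ofReal_measureReal, h1,
    ENNReal.ofReal_one]

/-- The probability of exceeding a separates the laws: at most e^{-1} for aν₀, at least e^{-a/b} >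
e^{-1} for bν₀. This covers a = 0 and b = ∞ as well. -/
theorem map_mul_ofReal_ne_of_lt (hν₀ : HasLaw ν₀ (expMeasure 1) P₀) {a b : ℝ≥0∞} (hab : a < b) :
    P₀.map (fun ω => a * ENNReal.ofReal (ν₀ ω)) ≠ P₀.map (fun ω => b * ENNReal.ofReal (ν₀ ω)) := by
  have hm : ∀ c : ℝ≥0∞, AEMeasurable (fun ω => c * ENNReal.ofReal (ν₀ ω)) P₀ := fun c =>
    hν₀.aemeasurable.ennreal_ofReal.const_mul c
  have ha : a ≠ ∞ := hab.ne_top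
  have hb : b ≠ 0 := (bot_le.trans_lt hab).ne'
  intro heq
  have h1 := congrArg (fun μ => μ.real (Ioi a)) heq
  simp only [map_measureReal_apply_of_aemeasurable (hm _) measurableSet_Ioi] at h1
  have hs : a / b < 1 := by
    rw [ENNReal.div_lt_iff (Or.inl hb) (Or.inr ha), one_mul]
    exact hab
  set s := (a / b).toReal with hs_def
  have hs1 : s < 1 := by
    rw [hs_def, ← ENNReal.toReal_one]
    exact (ENNReal.toReal_lt_toReal hs.ne_top ENNReal.one_ne_top).2 hs
  have h2 : P₀.real ((fun ω => a * ENNReal.ofReal (ν₀ ω)) ⁻¹' Ioi a) ≤ Real.exp (-1) := by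
    have h := measureReal_lt_of_hasLaw_expMeasure hν₀ 1
    rw [if_pos zero_le_one] at h
    rw [← h]
    refine measureReal_mono fun ω hω => ?_
    by_contra hle
    refine (show a < a * ENNReal.ofReal (ν₀ ω) from hω).not_ge ?_
    exact mul_le_of_le_one_right' (ENNReal.ofReal_le_one.2 (not_lt.1 hle))
  have h3 : Real.exp (-s) ≤ P₀.real ((fun ω => b * ENNReal.ofReal (ν₀ ω)) ⁻¹' Ioi a) := by
    have h := measureReal_lt_of_hasLaw_expMeasure hν₀ s
    rw [if_pos ENNReal.toReal_nonneg] at h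
    rw [← h]
    refine measureReal_mono fun ω hω => ?_
    have h4 : a / b < ENNReal.ofReal (ν₀ ω) := by
      rwa [ENNReal.lt_ofReal_iff_toReal_lt hs.ne_top]
    rw [ENNReal.div_lt_iff (Or.inl hb) (Or.inr ha), mul_comm] at h4
    exact h4
  have h5 : Real.exp (-1) < Real.exp (-s) := Real.exp_lt_exp.2 (by linarith)
  linarith

theorem eq_of_map_mul_ofReal_eq (hν₀ : HasLaw ν₀ (expMeasure 1) P₀) {a b : ℝ≥0∞}
    (h : P₀.map (fun ω => a * ENNReal.ofReal (ν₀ ω)) =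
      P₀.map (fun ω => b * ENNReal.ofReal (ν₀ ω))) : a = b := by
  rcases lt_trichotomy a b with hab | hab | hab
  · exact absurd h (map_mul_ofReal_ne_of_lt hν₀ hab)
  · exact hab
  · exact absurd h.symm (map_mul_ofReal_ne_of_lt hν₀ hab)

end Exponential

theorem IsMarkovRenewal.measurable_rewardFun {m : ℕ} {Ω : Type*} [MeasurableSpace Ω]
    {P : Measure Ω} {Q : Kernel (Fin m) (Fin m × ℝ≥0 × Fin 2)} {η : ℕ → Ω → Fin m}
    {κ : ℕ → Ω → ℝ≥0} {ζ : ℕ → Ω → Fin 2} (hX : IsMarkovRenewal P Q η κ ζ) (f : Fin m → ℝ)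
    (t : ℝ) : Measurable (rewardFun f η ζ t) := by
  have h : Measurable fun z : Ω × ℕ => ∑ n ∈ Finset.Icc 1 ⌊t * z.2⌋₊, f (η (n - 1) z.1) :=
    measurable_from_prod_countable_left fun c => by
      change Measurable fun ω => ∑ n ∈ Finset.Icc 1 ⌊t * (c : ℝ)⌋₊, f (η (n - 1) ω)
      exact Finset.measurable_fun_sum (f := fun n ω => f (η (n - 1) ω)) _ fun n _ =>
        (measurable_of_finite f).comp (hX.meas_state (n - 1))
  have h' := h.comp (measurable_id.prodMk hX.measurable_rareTime)
  exact h'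

/-! ### Transfer of convergence from a scalar to linear functions of it -/

section LinearLimit

variable {ι : Type*} {l : Filter ι} [l.IsCountablyGenerated] {Ω : ι → Type*}
  [∀ e, MeasurableSpace (Ω e)] {P : ∀ e, Measure (Ω e)} [∀ e, IsProbabilityMeasure (P e)]
  {Ω₀ : Type*} [MeasurableSpace Ω₀] {P₀ : Measure Ω₀} [IsProbabilityMeasure P₀]
  {Y : ∀ e, Ω e → ℝ} {Z : Ω₀ → ℝ}

theorem tendstoInDistribution_linear {X : ∀ e, Ω e → CadlagFun (Ici (0 : ℝ))}
    (hX : ∀ e, AEMeasurable (X e) (P e)) (hY : TendstoInDistribution Y l Z P P₀) (c : ℝ)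
    (hclose : ∀ T δ : ℝ, 0 < δ → Tendsto (fun e => (P e).real {ω | ∃ t : Ici (0 : ℝ),
      (t : ℝ) ≤ T ∧ δ < |(X e ω).toFun t - t * (c * Y e ω)|}) l (𝓝 0)) :
    TendstoInDistribution X l (fun ω => CadlagFun.linear (Ici 0) (c * Z ω)) P P₀ := by
  refine TendstoInDistribution.of_tendsto_measureReal_notMem
    (L := fun a => CadlagFun.linear (Ici 0) (c * a))
    ((CadlagFun.continuous_linear _).comp (continuous_const_mul c)) hX hY
    (V := fun n a => {x | ∀ t : Ici (0 : ℝ), (t : ℝ) ≤ n →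
      |x.toFun t - t * (c * a)| ≤ 1 / ((n : ℝ) + 1)}) ?_ ?_ ?_
  · intro n k a hnk x hx t ht
    refine (hx t (ht.trans (by exact_mod_cast hnk))).trans ?_
    gcongr
  · intro U hU a ha
    obtain ⟨K, hK, δ, hδ, hsub⟩ := CadlagFun.exists_jBall_subset hU ha
    -- Half of δ pays for the distance from the path to the line of slope cb, half for the change of
    -- slope from cb to ca on [0, R].
    obtain ⟨R, hR, hKR⟩ := CadlagFun.exists_forall_abs_le hK
    obtain ⟨n, hnR, hnδ⟩ : ∃ n : ℕ, R ≤ n ∧ 1 / ((n : ℝ) + 1) < δ / 2 :=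
      ((tendsto_natCast_atTop_atTop.eventually_ge_atTop R).and
        (tendsto_one_div_add_atTop_nhds_zero_nat.eventually_lt_const (half_pos hδ))).exists
    refine ⟨n, ?_⟩
    have hlim : Tendsto (fun b => R * |c * b - c * a|) (𝓝 a) (𝓝 0) := by
      have : Continuous fun b => R * |c * b - c * a| := by fun_prop
      simpa using this.tendsto a
    filter_upwards [hlim.eventually_lt_const (half_pos hδ)] with b hb
    refine fun x hx => hsub (CadlagFun.mem_jBall_of_forall_abs_lt hδ fun s hs => ?_)
    change |x.toFun s - s * (c * a)| < δ
    have h1 := hx s (((le_abs_self _).trans (hKR s hs)).trans hnR)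
    have h2 : |(s : ℝ) * (c * b) - s * (c * a)| ≤ R * |c * b - c * a| := by
      rw [← mul_sub, abs_mul]
      gcongr
      exact hKR s hs
    have h3 := abs_sub_le (x.toFun s) (s * (c * b)) (s * (c * a))
    linarith
  · intro n
    refine (hclose n (1 / ((n : ℝ) + 1)) (by positivity)).congr fun e => ?_
    congr 1
    ext ω
    simp

theorem tendstoInDistribution_const_mul {X : ∀ e, Ω e → ℝ}
    (hX : ∀ e, AEMeasurable (X e) (P e)) (hY : TendstoInDistribution Y l Z P P₀) (c : ℝ)
    (hclose : ∀ δ : ℝ, 0 < δ → Tendsto (fun e =>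
      (P e).real {ω | δ < |X e ω - c * Y e ω|}) l (𝓝 0)) :
    TendstoInDistribution X l (fun ω => c * Z ω) P P₀ := by
  refine TendstoInDistribution.of_tendsto_measureReal_notMem (L := fun a => c * a)
    (continuous_const_mul c) hX hY
    (V := fun n a => {x | |x - c * a| ≤ 1 / ((n : ℝ) + 1)}) ?_ ?_ ?_
  · intro n k a hnk x hx
    refine le_trans (show |x - c * a| ≤ 1 / ((k : ℝ) + 1) from hx) ?_
    change 1 / ((k : ℝ) + 1) ≤ 1 / ((n : ℝ) + 1)
    gcongr
  · intro U hU a ha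
    obtain ⟨δ, hδ, hsub⟩ := Metric.isOpen_iff.1 hU _ ha
    obtain ⟨n, hnδ⟩ :=
      (tendsto_one_div_add_atTop_nhds_zero_nat (𝕜 := ℝ).eventually_lt_const (half_pos hδ)).exists
    refine ⟨n, ?_⟩
    have hlim : Tendsto (fun b => |c * b - c * a|) (𝓝 a) (𝓝 0) := by
      have : Continuous fun b => |c * b - c * a| := by fun_prop
      simpa using this.tendsto a
    filter_upwards [hlim.eventually_lt_const (half_pos hδ)] with b hb
    refine fun x hx => hsub ?_
    have h1 : |x - c * b| ≤ 1 / ((n : ℝ) + 1) := hx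
    have h3 := abs_sub_le x (c * b) (c * a)
    rw [Metric.mem_ball, Real.dist_eq]
    linarith
  · intro n
    refine (hclose (1 / ((n : ℝ) + 1)) (by positivity)).congr fun e => ?_
    congr 1
    ext ω
    simp

end LinearLimit

/-! ### Convergence in distribution of the functionals -/

section Asymptotics

variable {ι : Type*} {l : Filter ι} [l.IsCountablyGenerated] {m : ℕ}
  {Q : ι → Kernel (Fin m) (Fin m × ℝ≥0 × Fin 2)}
  [∀ e, IsMarkovKernel (Q e)] {Ω : ι → Type*} [∀ e, MeasurableSpace (Ω e)]
  {P : ∀ e, Measure (Ω e)} [∀ e, IsProbabilityMeasure (P e)]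
  {η : ∀ e, ℕ → Ω e → Fin m} {κ : ∀ e, ℕ → Ω e → ℝ≥0} {ζ : ∀ e, ℕ → Ω e → Fin 2} {C : ℝ}
  {Ω₀ : Type*} [MeasurableSpace Ω₀] {P₀ : Measure Ω₀} [IsProbabilityMeasure P₀] {ν₀ : Ω₀ → ℝ}

theorem tendstoInDistribution_scaledTime
    (hX : ∀ e, IsMarkovRenewal (P e) (Q e) (η e) (κ e) (ζ e))
    (hC : ∀ᶠ e in l, IsPoissonBound (transProb (Q e)) (statDist (Q e)) C)
    (ha : Tendsto (fun e => avgRareProb (Q e)) l (𝓝 0))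
    (hpos : ∀ᶠ e in l, 0 < avgRareProb (Q e)) (hν₀ : HasLaw ν₀ (expMeasure 1) P₀) :
    TendstoInDistribution (fun e ω => scaledTime (Q e) (ζ e) ω) l ν₀ P P₀ := by
  refine tendstoInDistribution_of_tendsto_measureReal_gt
    (fun e => (measurable_scaledTime (hX e)).aemeasurable) hν₀.aemeasurable fun y => ?_
  rw [measureReal_lt_of_hasLaw_expMeasure hν₀]
  split_ifs with hy
  · exact tendsto_measureReal_lt_scaledTime hX hC ha hpos hy
  · refine tendsto_nhds_of_eventually_eq (hpos.mono fun e he => ?_)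
    have : {ω | y < scaledTime (Q e) (ζ e) ω} = univ := eq_univ_of_forall fun ω =>
      (not_le.1 hy).trans_le (mul_nonneg he.le (Nat.cast_nonneg _))
    rw [this, probReal_univ]

theorem tendstoInDistribution_scale_rewardPath
    (hX : ∀ e, IsMarkovRenewal (P e) (Q e) (η e) (κ e) (ζ e))
    (hC : ∀ᶠ e in l, IsPoissonBound (transProb (Q e)) (statDist (Q e)) C)
    (ha : Tendsto (fun e => avgRareProb (Q e)) l (𝓝 0))
    (hpos : ∀ᶠ e in l, 0 < avgRareProb (Q e)) (hν₀ : HasLaw ν₀ (expMeasure 1) P₀)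
    {f : ι → Fin m → ℝ} (hf : ∀ e i, 0 ≤ f e i)
    (hfpos : ∀ᶠ e in l, 0 < normFactor (Q e) (f e)) :
    TendstoInDistribution
      (fun e ω => (rewardPath (Ici 0) (f e) (η e) (ζ e) ω).scale (normFactor (Q e) (f e))⁻¹)
      l (fun ω => CadlagFun.linear (Ici 0) (ν₀ ω)) P P₀ := by
  have h := tendstoInDistribution_linear
    (X := fun e ω => (rewardPath (Ici 0) (f e) (η e) (ζ e) ω).scale (normFactor (Q e) (f e))⁻¹)
    (fun e => (measurable_map_rewardPath (hX e) _ _ _).aemeasurable)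
    (tendstoInDistribution_scaledTime hX hC ha hpos hν₀) 1 fun T δ hδ => ?_
  · simpa only [one_mul] using h
  refine squeeze_zero (fun _ => measureReal_nonneg) (fun e => measureReal_mono ?_)
    (tendsto_measureReal_exists_abs_inv_mul_rewardFun_sub hX hC ha hpos hf hfpos T hδ)
  rintro ω ⟨t, htT, ht⟩
  rw [one_mul] at ht
  exact ⟨t, t.2, htT, ht⟩

theorem tendstoInDistribution_rewardPath
    (hX : ∀ e, IsMarkovRenewal (P e) (Q e) (η e) (κ e) (ζ e))
    (hC : ∀ᶠ e in l, IsPoissonBound (transProb (Q e)) (statDist (Q e)) C)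
    (ha : Tendsto (fun e => avgRareProb (Q e)) l (𝓝 0))
    (hpos : ∀ᶠ e in l, 0 < avgRareProb (Q e)) (hν₀ : HasLaw ν₀ (expMeasure 1) P₀)
    {f : ι → Fin m → ℝ} (hf : ∀ e i, 0 ≤ f e i)
    (hfpos : ∀ᶠ e in l, 0 < normFactor (Q e) (f e)) {c : ℝ}
    (hc : Tendsto (fun e => normFactor (Q e) (f e)) l (𝓝 c)) :
    TendstoInDistribution (fun e ω => rewardPath (Ici 0) (f e) (η e) (ζ e) ω)
      l (fun ω => CadlagFun.linear (Ici 0) (c * ν₀ ω)) P P₀ := by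
  refine tendstoInDistribution_linear
    (fun e => (measurable_map_rewardPath (hX e) _ _ continuous_id).aemeasurable)
    (tendstoInDistribution_scaledTime hX hC ha hpos hν₀) c fun T δ hδ => ?_
  refine squeeze_zero (fun _ => measureReal_nonneg) (fun e => measureReal_mono ?_)
    (tendsto_measureReal_exists_abs_rewardFun_sub hX hC ha hpos hf hfpos hc T hδ)
  rintro ω ⟨t, htT, ht⟩
  exact ⟨t, t.2, htT, ht⟩

omit [l.IsCountablyGenerated] [∀ e, IsMarkovKernel (Q e)] in
theorem tendsto_normFactor_toReal {f : ι → Fin m → ℝ}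
    (hfpos : ∀ᶠ e in l, 0 < normFactor (Q e) (f e)) {f₀ : ℝ≥0∞} (hf₀ : f₀ ≠ ∞)
    (hI : Tendsto (fun e => ENNReal.ofReal (normFactor (Q e) (f e))) l (𝓝 f₀)) :
    Tendsto (fun e => normFactor (Q e) (f e)) l (𝓝 f₀.toReal) :=
  ((ENNReal.tendsto_toReal hf₀).comp hI).congr' (hfpos.mono fun _ he =>
    ENNReal.toReal_ofReal he.le)

theorem tendstoInDistribution_ofReal_rewardFun
    (hX : ∀ e, IsMarkovRenewal (P e) (Q e) (η e) (κ e) (ζ e))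
    (hC : ∀ᶠ e in l, IsPoissonBound (transProb (Q e)) (statDist (Q e)) C)
    (ha : Tendsto (fun e => avgRareProb (Q e)) l (𝓝 0))
    (hpos : ∀ᶠ e in l, 0 < avgRareProb (Q e)) (hν₀ : HasLaw ν₀ (expMeasure 1) P₀)
    {f : ι → Fin m → ℝ} (hf : ∀ e i, 0 ≤ f e i)
    (hfpos : ∀ᶠ e in l, 0 < normFactor (Q e) (f e)) {f₀ : ℝ≥0∞}
    (hI : Tendsto (fun e => ENNReal.ofReal (normFactor (Q e) (f e))) l (𝓝 f₀)) :
    TendstoInDistribution (fun e ω => ENNReal.ofReal (rewardFun (f e) (η e) (ζ e) 1 ω))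
      l (fun ω => f₀ * ENNReal.ofReal (ν₀ ω)) P P₀ := by
  have hY := tendstoInDistribution_scaledTime hX hC ha hpos hν₀
  have hmeas : ∀ e, Measurable (rewardFun (f e) (η e) (ζ e) 1) := fun e =>
    (hX e).measurable_rewardFun _ _
  by_cases hf₀ : f₀ = ∞
  · subst hf₀
    have h : TendstoInDistribution
        (fun e ω => ENNReal.ofReal (rewardFun (f e) (η e) (ζ e) 1 ω)) l
        (fun _ => (∞ : ℝ≥0∞)) P P₀ := by
      -- The scalar Y plays no role for a constant limit and only fills the slot of the criterion.
      refine TendstoInDistribution.of_tendsto_measureReal_notMem (L := fun _ => ∞)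
        continuous_const (fun e => (hmeas e).ennreal_ofReal.aemeasurable) hY
        (V := fun n _ => Ioi (n : ℝ≥0∞)) ?_ ?_ ?_
      · exact fun n k _ hnk => Ioi_subset_Ioi (by exact_mod_cast hnk)
      · intro U hU _ hmem
        obtain ⟨x, hx, hxU⟩ := ENNReal.nhds_top_basis.mem_iff.1 (hU.mem_nhds hmem)
        obtain ⟨n, hn⟩ := ENNReal.exists_nat_gt hx.ne
        exact ⟨n, Eventually.of_forall fun _ => (Ioi_subset_Ioi hn.le).trans hxU⟩
      · intro n
        refine squeeze_zero (fun _ => measureReal_nonneg) (fun e => measureReal_mono ?_)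
          (tendsto_measureReal_rewardFun_le hX hC ha hpos hf
            (ENNReal.tendsto_ofReal_nhds_top.1 hI) one_pos n)
        intro ω hω
        have h1 : ¬ (n : ℝ≥0∞) < ENNReal.ofReal (rewardFun (f e) (η e) (ζ e) 1 ω) := hω
        rwa [ENNReal.lt_ofReal_iff_toReal_lt (ENNReal.natCast_ne_top n), ENNReal.toReal_natCast,
          not_lt] at h1
    -- Since ∞ * 0 = 0, identifying ∞ * ν₀ with ∞ needs ν₀ > 0 almost surely.
    refine h.congr (fun e => ae_eq_rfl) ?_
    filter_upwards [ae_pos_of_hasLaw_expMeasure hν₀] with ω hω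
    rw [ENNReal.top_mul (ENNReal.ofReal_pos.2 hω).ne']
  · have hc := tendsto_normFactor_toReal hfpos hf₀ hI
    have h : TendstoInDistribution (fun e ω => rewardFun (f e) (η e) (ζ e) 1 ω) l
        (fun ω => f₀.toReal * ν₀ ω) P P₀ := by
      refine tendstoInDistribution_const_mul (fun e => (hmeas e).aemeasurable) hY _ fun δ hδ => ?_
      refine squeeze_zero (fun _ => measureReal_nonneg) (fun e => measureReal_mono ?_)
        (tendsto_measureReal_exists_abs_rewardFun_sub hX hC ha hpos hf hfpos hc 1 hδ)
      intro ω hω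
      exact ⟨1, zero_le_one, le_rfl, by rw [one_mul]; exact hω⟩
    refine (h.continuous_comp ENNReal.continuous_ofReal).congr (fun e => ae_eq_rfl)
      (Eventually.of_forall fun ω => ?_)
    simp only [Function.comp_apply]
    rw [ENNReal.ofReal_mul ENNReal.toReal_nonneg, ENNReal.ofReal_toReal hf₀]

/-- Compact subsets of (0, ∞) stay away from 0, and paths are monotone: once ν(1/(n+1)) exceeds T,
the cut path equals T from there on. -/
theorem tendstoInDistribution_cut_rewardPath
    (hX : ∀ e, IsMarkovRenewal (P e) (Q e) (η e) (κ e) (ζ e))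
    (hC : ∀ᶠ e in l, IsPoissonBound (transProb (Q e)) (statDist (Q e)) C)
    (ha : Tendsto (fun e => avgRareProb (Q e)) l (𝓝 0))
    (hpos : ∀ᶠ e in l, 0 < avgRareProb (Q e)) (hν₀ : HasLaw ν₀ (expMeasure 1) P₀)
    {f : ι → Fin m → ℝ} (hf : ∀ e i, 0 ≤ f e i)
    (hc : Tendsto (fun e => normFactor (Q e) (f e)) l atTop) (T : ℝ) :
    TendstoInDistribution (fun e ω => (rewardPath (Ioi 0) (f e) (η e) (ζ e) ω).cut T)
      l (fun _ => CadlagFun.const (Ioi 0) T) P P₀ := by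
  refine TendstoInDistribution.of_tendsto_measureReal_notMem
    (L := fun _ => CadlagFun.const (Ioi 0) T) continuous_const
    (fun e => (measurable_map_rewardPath (hX e) _ _ _).aemeasurable)
    (tendstoInDistribution_scaledTime hX hC ha hpos hν₀)
    (V := fun n _ => {x | ∀ t : Ioi (0 : ℝ), 1 / ((n : ℝ) + 1) ≤ t → x.toFun t = T}) ?_ ?_ ?_
  · intro n k a hnk x hx t ht
    refine hx t (le_trans ?_ ht)
    gcongr
  · intro U hU a ha
    obtain ⟨K, hK, δ, hδ, hsub⟩ := CadlagFun.exists_jBall_subset hU ha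
    obtain ⟨r, hr, hKr⟩ : ∃ r : ℝ, 0 < r ∧ ∀ s ∈ K, r ≤ (s : ℝ) := by
      rcases K.eq_empty_or_nonempty with rfl | hne
      · exact ⟨1, one_pos, fun s hs => hs.elim⟩
      · obtain ⟨s, _, hs⟩ := hK.exists_isMinOn hne
          (continuous_subtype_val (p := fun x => x ∈ Ioi (0 : ℝ))).continuousOn
        exact ⟨s, s.2, fun t ht => hs ht⟩
    obtain ⟨n, hn⟩ := exists_nat_one_div_lt hr
    refine ⟨n, Eventually.of_forall fun b x hx => hsub
      (CadlagFun.mem_jBall_of_forall_abs_lt hδ fun s hs => ?_)⟩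
    change |x.toFun s - T| < δ
    rw [hx s (hn.le.trans (hKr s hs)), sub_self, abs_zero]
    exact hδ
  · intro n
    refine squeeze_zero (fun _ => measureReal_nonneg) (fun e => measureReal_mono ?_)
      (tendsto_measureReal_rewardFun_le hX hC ha hpos hf hc (t := 1 / ((n : ℝ) + 1))
        (by positivity) T)
    intro ω hω
    by_contra hlt
    refine hω fun t ht => ?_
    change min T (rewardFun (f e) (η e) (ζ e) t ω) = T
    exact min_eq_left ((not_le.1 hlt).le.trans (rewardFun_mono (hf e) _ _ ω ht))

end Asymptotics

/-! ### The conditions on the perturbed processes -/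

section Conditions

variable {m : ℕ} {ε₀ : ℝ} {Q : Pert ε₀ → Kernel (Fin m) (Fin m × ℝ≥0 × Fin 2)}
  [∀ ε, IsMarkovKernel (Q ε)]

theorem toZero_neBot (hε₀ : 0 < ε₀) : (toZero ε₀).NeBot :=
  comap_coe_neBot_of_le_principal (le_principal_iff.2 (Ioc_mem_nhdsGT hε₀))

instance : (toZero ε₀).IsCountablyGenerated := by
  unfold toZero
  infer_instance

/-- One δ below the finitely many lower limits makes the ring uniform for small ε. A stationary
distribution then exists, so the choice made in `statDist` is a genuine one. -/
theorem CondB.exists_isPoissonBound (hB : CondB Q) :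
    ∃ C, ∀ᶠ ε in toZero ε₀, IsPoissonBound (transProb (Q ε)) (statDist (Q ε)) C := by
  obtain ⟨N, c, hN, hc, hlim⟩ := hB
  have : NeZero m := ⟨(c 0).pos.ne'⟩
  obtain ⟨δ, hδ, hδ1, hδ0⟩ : ∃ δ : ℝ, (∀ k ∈ Finset.range N,
      δ < liminf (fun ε => transProb (Q ε) (c k) (c (k + 1))) (toZero ε₀)) ∧ δ < 1 ∧ 0 < δ := by
    have h1 : ∀ᶠ δ : ℝ in 𝓝[>] 0, ∀ k ∈ Finset.range N,
        δ < liminf (fun ε => transProb (Q ε) (c k) (c (k + 1))) (toZero ε₀) :=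
      (Finset.eventually_all _).2 fun k hk =>
        (eventually_lt_nhds (hlim k (Finset.mem_range.1 hk))).filter_mono nhdsWithin_le_nhds
    have h2 : ∀ᶠ δ : ℝ in 𝓝[>] 0, δ < 1 :=
      (eventually_lt_nhds one_pos).filter_mono nhdsWithin_le_nhds
    exact (h1.and (h2.and self_mem_nhdsWithin)).exists
  refine ⟨m * (2 / δ) ^ (2 * N), ?_⟩
  have hedge : ∀ᶠ ε in toZero ε₀, ∀ k ∈ Finset.range N, δ < transProb (Q ε) (c k) (c (k + 1)) :=
    (Finset.eventually_all _).2 fun k hk => eventually_lt_of_lt_liminf (hδ k hk)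
      (isBoundedUnder_of ⟨0, fun ε => transProb_nonneg (Q ε) _ _⟩)
  filter_upwards [hedge] with ε hε
  have hring : IsRingStochastic (transProb (Q ε)) N c δ :=
    ⟨transProb_nonneg (Q ε), sum_transProb (Q ε), hN, hc,
      fun k hk => (hε k (Finset.mem_range.2 hk)).le⟩
  exact hring.isPoissonBound hδ0 hδ1.le
    (Classical.epsilon_spec (exists_isStationaryDist hring.nonneg hring.sum_eq_one))

omit [∀ ε, IsMarkovKernel (Q ε)] in
theorem CondA.tendsto_avgRareProb (hA : CondA Q) {C : ℝ}
    (hC : ∀ᶠ ε in toZero ε₀, IsPoissonBound (transProb (Q ε)) (statDist (Q ε)) C) :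
    Tendsto (fun ε => avgRareProb (Q ε)) (toZero ε₀) (𝓝 0) := by
  refine squeeze_zero' (hC.mono fun ε hε => ?_) (hC.mono fun ε hε => ?_) hA.2
  · exact Finset.sum_nonneg fun i _ => mul_nonneg (hε.stationary.1 i) (rareProb_nonneg _ i)
  · calc avgRareProb (Q ε) ≤ ∑ i, statDist (Q ε) i * ⨆ j, rareProb (Q ε) j :=
          Finset.sum_le_sum fun i _ => mul_le_mul_of_nonneg_left
            (le_ciSup (Finite.bddAbove_range _) i) (hε.stationary.1 i)
      _ = ⨆ j, rareProb (Q ε) j := by rw [← Finset.sum_mul, hε.stationary.2.2, one_mul]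

omit [∀ ε, IsMarkovKernel (Q ε)] in
-- Some p_i is positive, and p_i ≤ Cp.
theorem CondA.eventually_avgRareProb_pos (hA : CondA Q) {C : ℝ}
    (hC : ∀ᶠ ε in toZero ε₀, IsPoissonBound (transProb (Q ε)) (statDist (Q ε)) C) :
    ∀ᶠ ε in toZero ε₀, 0 < avgRareProb (Q ε) := by
  filter_upwards [hA.1, hC] with ε hε hCε
  obtain ⟨i, hi⟩ : ∃ i, 0 < rareProb (Q ε) i := by
    by_contra! hcon
    exact hε.not_ge (Real.iSup_nonpos hcon)
  exact (pos_iff_pos_of_mul_pos (hi.trans_le (rareProb_le _ hCε i))).1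
    (one_pos.trans_le hCε.one_le)

end Conditions

/-! ### The main theorem -/

theorem lemma8 {m : ℕ} {ε₀ : ℝ} (hε₀ : 0 < ε₀)
    (Q : Pert ε₀ → Kernel (Fin m) (Fin m × ℝ≥0 × Fin 2)) [∀ ε, IsMarkovKernel (Q ε)]
    (f : Pert ε₀ → Fin m → ℝ) (hf : ∀ ε i, 0 ≤ f ε i)
    (hA : CondA Q) (hB : CondB Q) (hH : CondH Q f)
    -- Markov renewal processes with transition laws `Q ε` and any initial distributions
    (Ω : Pert ε₀ → Type*) [∀ ε, MeasurableSpace (Ω ε)]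
    (P : ∀ ε, Measure (Ω ε)) [∀ ε, IsProbabilityMeasure (P ε)]
    (η : ∀ ε, ℕ → Ω ε → Fin m) (κ : ∀ ε, ℕ → Ω ε → ℝ≥0) (ζ : ∀ ε, ℕ → Ω ε → Fin 2)
    (hX : ∀ ε, IsMarkovRenewal (P ε) (Q ε) (η ε) (κ ε) (ζ ε))
    -- an exponentially distributed random variable `ν₀` with parameter `1`
    (Ω₀ : Type*) [MeasurableSpace Ω₀] (P₀ : Measure Ω₀) [IsProbabilityMeasure P₀]
    (ν₀ : Ω₀ → ℝ) (hν₀ : HasLaw ν₀ (expMeasure 1) P₀) :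
    -- (i)
    TendstoInDistribution
      (fun ε ω => (rewardPath (Ici 0) (f ε) (η ε) (ζ ε) ω).scale (normFactor (Q ε) (f ε))⁻¹)
      (toZero ε₀) (fun ω => CadlagFun.linear (Ici 0) (ν₀ ω)) P P₀ ∧
    -- (ii) necessity of condition I, and (iii)
    (∀ (μ : Measure ℝ≥0∞) [IsProbabilityMeasure μ],
      TendstoInDistribution (fun ε ω => ENNReal.ofReal (rewardFun (f ε) (η ε) (ζ ε) 1 ω))
        (toZero ε₀) (id : ℝ≥0∞ → ℝ≥0∞) P μ →
      ∃ f₀ : ℝ≥0∞, CondI Q f f₀ ∧ μ = P₀.map (fun ω => f₀ * ENNReal.ofReal (ν₀ ω))) ∧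
    ∀ f₀ : ℝ≥0∞, CondI Q f f₀ →
      -- (ii) sufficiency of condition I, and (iii)
      TendstoInDistribution (fun ε ω => ENNReal.ofReal (rewardFun (f ε) (η ε) (ζ ε) 1 ω))
        (toZero ε₀) (fun ω => f₀ * ENNReal.ofReal (ν₀ ω)) P P₀ ∧
      -- (iv)
      (f₀ ≠ ∞ → TendstoInDistribution
        (fun ε ω => rewardPath (Ici 0) (f ε) (η ε) (ζ ε) ω)
        (toZero ε₀) (fun ω => CadlagFun.linear (Ici 0) (f₀.toReal * ν₀ ω)) P P₀) ∧
      (f₀ = ∞ →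
        -- (v)
        (∀ T : ℝ, 0 < T → TendstoInDistribution
          (fun ε ω => (rewardPath (Ioi 0) (f ε) (η ε) (ζ ε) ω).cut T)
          (toZero ε₀) (fun _ => CadlagFun.const (Ioi 0) T) P P₀) ∧
        -- (vi)
        (∀ t : ℝ, 0 < t → ∀ M : ℝ,
          Tendsto (fun ε => P ε {ω | rewardFun (f ε) (η ε) (ζ ε) t ω ≤ M}) (toZero ε₀) (𝓝 0))) := by
  have := toZero_neBot hε₀
  obtain ⟨C, hC⟩ := hB.exists_isPoissonBound
  have ha := hA.tendsto_avgRareProb hC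
  have hpos := hA.eventually_avgRareProb_pos hC
  -- Stated along any finer countably generated filter, so that it also applies along subsequences.
  have hsuff : ∀ l : Filter (Pert ε₀), l.IsCountablyGenerated → l ≤ toZero ε₀ → ∀ f₀ : ℝ≥0∞,
      Tendsto (fun ε => ENNReal.ofReal (normFactor (Q ε) (f ε))) l (𝓝 f₀) →
      TendstoInDistribution (fun ε ω => ENNReal.ofReal (rewardFun (f ε) (η ε) (ζ ε) 1 ω))
        l (fun ω => f₀ * ENNReal.ofReal (ν₀ ω)) P P₀ := fun l _ hl f₀ hI =>
    tendstoInDistribution_ofReal_rewardFun hX (hC.filter_mono hl) (ha.mono_left hl)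
      (hpos.filter_mono hl) hν₀ hf (hH.filter_mono hl) hI
  refine ⟨tendstoInDistribution_scale_rewardPath hX hC ha hpos hν₀ hf hH, fun μ _ hμ => ?_,
    fun f₀ hI => ⟨hsuff _ inferInstance le_rfl f₀ hI, fun hf₀ => ?_, fun hf₀ => ?_⟩⟩
  -- Compactness of [0, ∞] extracts a limit point c of the normalizing factors; uniqueness of weak
  -- limits forces μ to be the law of cν₀.
  · have hsub : ∀ u : ℕ → Pert ε₀, Tendsto u atTop (toZero ε₀) → ∃ c : ℝ≥0∞, ∃ φ : ℕ → ℕ,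
        Tendsto (fun n => ENNReal.ofReal (normFactor (Q (u (φ n))) (f (u (φ n))))) atTop (𝓝 c) ∧
        μ = P₀.map (fun ω => c * ENNReal.ofReal (ν₀ ω)) := by
      intro u hu
      obtain ⟨c, φ, hφ, hc⟩ := CompactSpace.tendsto_subseq
        fun n => ENNReal.ofReal (normFactor (Q (u n)) (f (u n)))
      have hle : map (u ∘ φ) atTop ≤ toZero ε₀ := hu.comp hφ.tendsto_atTop
      have h1 := hsuff (map (u ∘ φ) atTop) inferInstance hle c (tendsto_map'_iff.2 hc)
      have h2 : TendstoInDistribution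
          (fun ε ω => ENNReal.ofReal (rewardFun (f ε) (η ε) (ζ ε) 1 ω))
          (map (u ∘ φ) atTop) (id : ℝ≥0∞ → ℝ≥0∞) P μ :=
        ⟨hμ.forall_aemeasurable, hμ.aemeasurable_limit, hμ.tendsto.mono_left hle⟩
      refine ⟨c, φ, hc, ?_⟩
      rw [← tendstoInDistribution_unique _ h2 h1, Measure.map_id]
    obtain ⟨u, hu⟩ := exists_seq_tendsto (toZero ε₀)
    obtain ⟨f₀, _, _, hf₀⟩ := hsub u hu
    refine ⟨f₀, tendsto_of_subseq_tendsto fun v hv => ?_, hf₀⟩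
    obtain ⟨c, φ, hc, hcμ⟩ := hsub v hv
    -- All limit points coincide, because the law of cν₀ determines c.
    obtain rfl : f₀ = c := eq_of_map_mul_ofReal_eq hν₀ (hf₀.symm.trans hcμ)
    exact ⟨φ, hc⟩
  · exact tendstoInDistribution_rewardPath hX hC ha hpos hν₀ hf hH
      (tendsto_normFactor_toReal hH hf₀ hI)
  · have hc : Tendsto (fun ε => normFactor (Q ε) (f ε)) (toZero ε₀) atTop :=
      ENNReal.tendsto_ofReal_nhds_top.1 (hf₀ ▸ hI)
    refine ⟨fun T _ => tendstoInDistribution_cut_rewardPath hX hC ha hpos hν₀ hf hc T,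
      fun t ht M => ?_⟩
    rw [← ENNReal.tendsto_toReal_iff (fun _ => measure_ne_top _ _) ENNReal.zero_ne_top]
    exact tendsto_measureReal_rewardFun_le hX hC ha hpos hf hc ht M
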